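/- A \emph{signed digraph} $G$ on a finite vertex set $V$, with $n=|V|$, is a set $E\subseteq V\times V\times\{-1,1\}$ of signed arcs (loops, and both a positive and a negative arc from one vertex to another, are allowed). Paths and cycles are directed and have no repeated vertices (a loop is a cycle), and their sign is the product of the signs of their arcs. Notions that do not involve signs, such as strong components, refer to the underlying unsigned digraph. A \emph{source} is a vertex of in-degree zero. An \emph{initial cycle} of $G$ is a strong component that no arc enters from outside and that is isomorphic to a directed cycle. A path is \emph{forward} if it has at least one arc and the two vertices of its last arc belong to distinct strong components. $G$ is \emph{homogenous} if for every vertex $i$, each strong component of $G$ contains a vertex $j$ such that all forward paths from $j$ to $i$ have the same sign. A \emph{Boolean network} is a map $f:\{0,1\}^V\to\{0,1\}^V$. Its \emph{signed interaction digraph} has a positive (negative) arc from $j$ to $i$ if there is a configuration $x$ with $x_j=0$ such that changing $x_j$ to $1$ increases (decreases) $f_i(x)$. We say that $f$ is an \emph{and-or-net on $G$} if its signed interaction digraph is $G$ and for every $i\in V$ there is $a\in\{0,1\}$ such that, for all $x$, $f_i(x)=a$ if and only if $x_j=a$ for every positive arc of $G$ from $j$ to $i$ and $x_j\ne a$ for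 every negative arc of $G$ from $j$ to $i$. For $i\in V$, let $f^i(x)$ be obtained from $x$ by replacing $x_i$ with $f_i(x)$, and for a word $w=i_1\cdots i_\ell$ over $V$ let $f^w=f^{i_\ell}\circ\cdots\circ f^{i_1}$. The word $w$ is \emph{synchronizing} for $f$ if $f^w$ is constant. \textbf{Theorem.} Suppose that $G$ is homogenous and has no positive cycles, no sources and no initial cycles. Then every and-or-net on $G$ has a synchronizing word of length at most $10(\sqrt5+1)^n$. -/

import Mathlib

/-- A signed digraph with vertex set `V`: a set of signed arcs, that is, a subset of `V × V × {-1, 1}`.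
`G.Arc j i s` means that there is an arc of sign `s` from `j` to `i`. A positive and a negative arc
from `j` to `i` may both be present, and loops are allowed. -/
structure SignedDigraph (V : Type*) where
  Arc : V → V → ℤˣ → Prop

namespace SignedDigraph

variable {V : Type*} (G : SignedDigraph V)

/-- The underlying (unsigned) digraph. -/
def Adj (j i : V) : Prop := ∃ s, G.Arc j i s

/-- There is a (possibly empty) directed walk from `j` to `i`. -/
def Reach (j i : V) : Prop := Relation.ReflTransGen G.Adj j i

/-- `j` and `i` belong to the same strong component. -/
def SameComponent (j i : V) : Prop := G.Reach j i ∧ G.Reach i j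

/-- The strong components of `G`, as vertex sets. -/
def IsStrongComponent (I : Set V) : Prop := ∃ i, I = {j | G.SameComponent j i}

/-- `[(s₁, v₁), …, (sₖ, vₖ)]` is a directed walk from `j` to `i`: the arcs are `j → v₁` of sign `s₁`,
`v₁ → v₂` of sign `s₂`, …, and `vₖ = i` (`j = i` if the list is empty). -/
def IsWalk : V → List (ℤˣ × V) → V → Prop
  | j, [], i => j = i
  | j, (s, k) :: p, i => G.Arc j k s ∧ IsWalk k p i

/-- The product of the signs of the arcs. -/
def sign (p : List (ℤˣ × V)) : ℤˣ := (p.map Prod.fst).prod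

/-- A path from `j` to `i`: a walk without repeated vertices. -/
def IsPath (j : V) (p : List (ℤˣ × V)) (i : V) : Prop :=
  G.IsWalk j p i ∧ (j :: p.map Prod.snd).Nodup

/-- A cycle, described from its vertex `j`: a closed walk with at least one arc whose only repetition
of vertices is that it ends where it starts. A loop is a cycle. -/
def IsCycle (j : V) (p : List (ℤˣ × V)) : Prop :=
  p ≠ [] ∧ G.IsWalk j p j ∧ (p.map Prod.snd).Nodup

/-- All the cycles are negative. -/
def NoPositiveCycle : Prop := ∀ j p, G.IsCycle j p → sign p ≠ 1

/-- A vertex of in-degree zero. -/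
def IsSource (i : V) : Prop := ∀ j, ¬ G.Adj j i

/-- `I` is the vertex set of an initial cycle: an initial strong component (no arc enters it from
outside) that is isomorphic to a directed cycle with `k ≥ 1` vertices. -/
def IsInitialCycle (I : Set V) : Prop :=
  G.IsStrongComponent I ∧ (∀ j i, j ∉ I → i ∈ I → ¬ G.Adj j i) ∧
    ∃ k : ℕ, 1 ≤ k ∧ ∃ e : ZMod k ≃ I, ∀ t u : ZMod k, G.Adj (e t) (e u) ↔ u = t + 1

/-- A forward path: a path with at least one arc, such that the two vertices `k`, `i` of its last arc
belong to distinct strong components. -/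
def IsForwardPath (j : V) (p : List (ℤˣ × V)) (i : V) : Prop :=
  G.IsPath j p i ∧ ∃ q s k, p = q ++ [(s, i)] ∧ G.IsWalk j q k ∧ ¬ G.SameComponent k i

/-- Each strong component contains a vertex `j` such that all the forward paths from `j` to `i` have
the same sign. -/
def HomogenousAt (i : V) : Prop :=
  ∀ I, G.IsStrongComponent I → ∃ j ∈ I, ∀ p q,
    G.IsForwardPath j p i → G.IsForwardPath j q i → sign p = sign q

def Homogenous : Prop := ∀ i, G.HomogenousAt i

end SignedDigraph

/-- A Boolean network with component set `V`. -/
abbrev BooleanNetwork (V : Type*) := (V → Bool) → (V → Bool)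

namespace BooleanNetwork

variable {V : Type*} [DecidableEq V] (f : BooleanNetwork V)

/-- The signed interaction digraph: a positive (negative) arc from `j` to `i` if switching
component `j` from 0 to 1 in some configuration increases (decreases) `f_i`. -/
def interactionDigraph : SignedDigraph V where
  Arc j i s := ∃ x : V → Bool, x j = false ∧
    ((s = 1 ∧ f x i = false ∧ f (Function.update x j true) i = true) ∨
      (s = -1 ∧ f x i = true ∧ f (Function.update x j true) i = false))

/-- `f_i` is the conjunction of the literals given by the arcs of `G` entering `i`. -/
def IsConjunctionAt (G : SignedDigraph V) (i : V) : Prop :=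
  ∀ x, f x i = true ↔
    (∀ j, G.Arc j i 1 → x j = true) ∧ (∀ j, G.Arc j i (-1) → x j = false)

/-- `f_i` is the disjunction of the literals given by the arcs of `G` entering `i`. -/
def IsDisjunctionAt (G : SignedDigraph V) (i : V) : Prop :=
  ∀ x, f x i = false ↔
    (∀ j, G.Arc j i 1 → x j = false) ∧ (∀ j, G.Arc j i (-1) → x j = true)

/-- `f` is an and-or-net on `G`: its signed interaction digraph is `G`, and each component is a
conjunction or a disjunction. -/
def IsAndOrNetOn (G : SignedDigraph V) : Prop :=
  f.interactionDigraph = G ∧ ∀ i, f.IsConjunctionAt G i ∨ f.IsDisjunctionAt G i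

/-- The action `f^i` of the letter `i`: update component `i` only. -/
def step (i : V) (x : V → Bool) : V → Bool := Function.update x i (f x i)

/-- The action `f^w` of a word `w`, whose letters are applied from left to right. -/
def act (w : List V) (x : V → Bool) : V → Bool := w.foldl (fun y i => f.step i y) x

/-- `w` is a synchronizing word for `f`: `f^w` is a constant function. -/
def IsSynchronizingWord (w : List V) : Prop := ∃ z, ∀ x, f.act w x = z

end BooleanNetwork

/-! ### Updating along words. -/

namespace BooleanNetwork

variable {V : Type*} [DecidableEq V] (f : BooleanNetwork V)

/-! Call an arc consistent in x if its sign matches the values at its ends. The sign of a path of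
consistent arcs depends only on its two end values, so a cycle of consistent arcs is positive. Since
all cycles are negative, in every configuration each nonempty vertex set has a member with no
consistent input in that set (`NoConsistentCycle`). A vertex with no consistent input at all, here
called loose, flips when it is updated.

The flip lemma (`FlipState.goal`) makes a vertex loose. Suppose that only the vertices of R may be
updated and that every vertex outside R, except those of a target set T, has a consistent input
outside R. Then some target becomes loose. A vertex e of R with an input outside R is either already
accounted for by that input, or is added to the targets, made loose, flipped, and thereby accounted
for. This calls the lemma twice on smaller sets. Two savings turn the doubling into a Fibonacci
recursion: if e feeds another vertex of R, one of its two values forces that vertex; if not, the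
flip of e can be deferred. Parts of R that cannot be accessed from outside are handled by
homogeneity, which provides virtual arcs leading back into them (`VirtuallyAccessible`). The result
is `exists_loose`, with cost below 2 fib(|R| + 2).

To merge configurations x and y, let D be the set on which they differ and s the maximal size of an
acyclic vertex set. By `shrink_or_rigid`, either D shrinks within s + 2 updates, or every vertex of
D has exactly one input in D and neutral inputs elsewhere. In the rigid case the cycles of D are cut
by a set U of vertices that also have inputs outside D, because no initial component is a cycle. The
difference is then spread outwards like an infection (`Spread.breached_or_invaded`). Either some
outside input of D loses its neutral value and D shrinks, or the infection reaches an input of some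
v in U, and the difference can be made cut by U without v (`Invaded.exists_cut`). A double induction
on |U| and |D| gives `exists_merge`.

Stabilizing a maximum acyclic set leaves at most 2^(n - s) configurations, which are merged one pair
at a time. Each merge costs at most 2^s times a quantity below 10 φ^n, where φ is the golden ratio,
and 2φ = √5 + 1. -/

theorem act_nil (x : V → Bool) : f.act [] x = x := rfl

theorem act_cons (i : V) (w : List V) (x : V → Bool) :
    f.act (i :: w) x = f.act w (f.step i x) := rfl

theorem act_append (w w' : List V) (x : V → Bool) :
    f.act (w ++ w') x = f.act w' (f.act w x) := by
  simp [act, List.foldl_append]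

theorem step_self (i : V) (x : V → Bool) : f.step i x i = f x i := by
  simp [step]

theorem step_of_ne {i j : V} (h : j ≠ i) (x : V → Bool) : f.step i x j = x j := by
  simp [step, h]

theorem step_eq_self {i : V} {x : V → Bool} (h : f x i = x i) : f.step i x = x := by
  simp [step, h]

theorem act_of_notMem {w : List V} {j : V} (h : j ∉ w) (x : V → Bool) : f.act w x j = x j := by
  induction w generalizing x with
  | nil => rfl
  | cons i w ih =>
    simp only [List.mem_cons, not_or] at h
    rw [act_cons, ih h.2, step_of_ne f h.1]

end BooleanNetwork

/-! ### Nets of conjunctions and disjunctions, and consistent arcs. -/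

/-- A net whose local functions are conjunctions or disjunctions of literals: component `i` takes the
value `top i` if all of its inputs `j` take the value `lit j i`, and the value `!top i` otherwise. -/
structure CanalizingNet (V : Type*) where
  inputs : V → Finset V
  lit : V → V → Bool
  top : V → Bool

namespace CanalizingNet

variable {V : Type*} (N : CanalizingNet V)

/-- The Boolean network defined by `N`. -/
def map : BooleanNetwork V :=
  fun x i => if ∀ j ∈ N.inputs i, x j = N.lit j i then N.top i else !N.top i

/-- The arc from `j` to `i` is consistent in `x`. -/
def Cons (x : V → Bool) (j i : V) : Prop := (x j = N.lit j i ↔ x i = N.top i)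

/-- The net induces no cycle on `S`. -/
def Acyc (S : Finset V) : Prop := ∀ W ⊆ S, W.Nonempty → ∃ b ∈ W, ∀ j ∈ W, j ∉ N.inputs b

/-- No configuration makes all the arcs of a cycle consistent. -/
def NoConsistentCycle : Prop :=
  ∀ x, ∀ S : Finset V, S.Nonempty → ∃ b ∈ S, ∀ j ∈ S, j ∈ N.inputs b → ¬ N.Cons x j b

variable {N}

theorem map_eq_top {x : V → Bool} {i : V} (h : ∀ j ∈ N.inputs i, x j = N.lit j i) :
    N.map x i = N.top i := if_pos h

theorem map_eq_not_top {x : V → Bool} {i j : V} (hj : j ∈ N.inputs i) (h : x j ≠ N.lit j i) :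
    N.map x i = !N.top i := if_neg fun h' => h (h' j hj)

theorem map_congr {x y : V → Bool} {i : V} (h : ∀ j ∈ N.inputs i, x j = y j) :
    N.map x i = N.map y i := by
  have : (∀ j ∈ N.inputs i, x j = N.lit j i) ↔ ∀ j ∈ N.inputs i, y j = N.lit j i :=
    forall₂_congr fun j hj => by rw [h j hj]
  simp only [map, this]

theorem Cons.congr {x y : V → Bool} {j i : V} (h : N.Cons x j i) (hj : y j = x j)
    (hi : y i = x i) : N.Cons y j i := by
  unfold Cons at *; rwa [hj, hi]

theorem cons_compl {x y : V → Bool} {j i : V} (hj : x j ≠ y j) (hi : x i ≠ y i) :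
    N.Cons y j i ↔ N.Cons x j i := by
  unfold Cons
  generalize x j = a, x i = b, y j = c, y i = d, N.lit j i = e, N.top i = f at *
  revert a b c d e f
  decide

theorem Cons.of_flip {N : CanalizingNet V} {x y : V → Bool} {j i : V} (h : ¬ N.Cons x j i)
    (hj : y j = x j) (hi : y i = !x i) : N.Cons y j i := by
  have : (!x i) = N.top i ↔ ¬ x i = N.top i := by cases x i <;> cases N.top i <;> simp
  unfold Cons at *
  rw [hj, hi, this]
  tauto

theorem ne_top_iff {N : CanalizingNet V} {i : V} {a : Bool} : a ≠ N.top i ↔ a = !N.top i := by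
  cases a <;> cases N.top i <;> simp

/-- A vertex without consistent input flips when it is updated. -/
theorem map_eq_not_of_loose {x : V → Bool} {i : V} (hne : (N.inputs i).Nonempty)
    (h : ∀ j ∈ N.inputs i, ¬ N.Cons x j i) : N.map x i = !x i := by
  by_cases hi : x i = N.top i
  · obtain ⟨j, hj⟩ := hne
    have hn : x j ≠ N.lit j i := fun hc => h j hj (by unfold Cons; tauto)
    rw [map_eq_not_top hj hn, hi]
  · have : ∀ j ∈ N.inputs i, x j = N.lit j i := fun j hj => by
      by_contra hc
      exact h j hj (by unfold Cons; tauto)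
    rw [map_eq_top this, ne_top_iff.1 hi, Bool.not_not]

/-- In `x`, every vertex of `R` has an input in `R` and all its inputs outside `R` are neutral. -/
def Reduced (N : CanalizingNet V) (R : Finset V) (x : V → Bool) : Prop :=
  ∀ e ∈ R, (∀ j ∈ N.inputs e, j ∉ R → x j = N.lit j e) ∧ ∃ j ∈ N.inputs e, j ∈ R

variable [DecidableEq V]

/-- A vertex of `R` whose value is decided by the inputs outside `R` can be updated, and then
it has a consistent input outside `R`. -/
theorem exists_forced {R : Finset V} {x : V → Bool} (hs : ∀ i, (N.inputs i).Nonempty)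
    (h : ¬ N.Reduced R x) : ∃ e ∈ R, ∃ j ∈ N.inputs e, j ∉ R ∧ N.Cons (N.map.step e x) j e := by
  unfold Reduced at h
  push Not at h
  obtain ⟨e, he, h⟩ := h
  by_cases h1 : ∀ j ∈ N.inputs e, j ∉ R → x j = N.lit j e
  · have h2 := h h1
    obtain ⟨j, hj⟩ := hs e
    have hall : ∀ j ∈ N.inputs e, x j = N.lit j e := fun j hj => h1 j hj (h2 j hj)
    refine ⟨e, he, j, hj, h2 j hj, ?_⟩
    have hje : j ≠ e := fun h' => h2 j hj (h' ▸ he)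
    unfold Cons
    rw [BooleanNetwork.step_self, BooleanNetwork.step_of_ne _ hje, map_eq_top hall]
    simp [hall j hj]
  · push Not at h1
    obtain ⟨j, hj, hjR, hn⟩ := h1
    refine ⟨e, he, j, hj, hjR, ?_⟩
    have hje : j ≠ e := fun h' => hjR (h' ▸ he)
    unfold Cons
    rw [BooleanNetwork.step_self, BooleanNetwork.step_of_ne _ hje, map_eq_not_top hj hn]
    simp [hn]

end CanalizingNet

/-! ### The flip lemma. -/

namespace CanalizingNet

variable {V : Type*}

/-- `j` accounts for the value of `b`: through a consistent arc, or through a virtual arc to `b`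
whose wanted value is the value of `b`. -/
def Par (N : CanalizingNet V) (vt : V → V → Prop) (β : V → Bool) (x : V → Bool) (j b : V) : Prop :=
  (j ∈ N.inputs b ∧ N.Cons x j b) ∨ (vt j b ∧ x b = β b)

theorem Par.congr {N : CanalizingNet V} {vt : V → V → Prop} {β : V → Bool} {x y : V → Bool}
    {j b : V} (h : N.Par vt β x j b) (hj : y j = x j) (hb : y b = x b) : N.Par vt β y j b := by
  rcases h with h | h
  · exact Or.inl ⟨h.1, h.2.congr hj hb⟩
  · exact Or.inr ⟨h.1, hb.trans h.2⟩

variable [DecidableEq V]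

/-- The setting of the flip lemma. -/
structure FlipFrame (N : CanalizingNet V) (Γ R₀ Q : Finset V) (x₀ : V → Bool)
    (vt : V → V → Prop) (β : V → Bool) (α : ℕ) : Prop where
  source : ∀ i, (N.inputs i).Nonempty
  root : ∀ x : V → Bool, (∀ j ∉ R₀, x j = x₀ j) → ∀ S ⊆ Γ, S.Nonempty →
    ∃ b ∈ S, ∀ j ∈ S, ¬ N.Par vt β x j b
  entry : ∀ R, Q ⊆ R → R ⊆ R₀ → R ≠ Q →
    ∃ e ∈ R, e ∉ Q ∧ ∃ j ∈ Γ, j ∉ R ∧ (j ∈ N.inputs e ∨ vt j e)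
  vt_notMem : ∀ j b, vt j b → j ∉ R₀
  subset : Q ⊆ R₀
  closed : ∀ e ∈ Q, N.inputs e ⊆ Q
  inputs_subset : ∀ e ∈ R₀, N.inputs e ⊆ Γ
  subset' : R₀ ⊆ Γ
  nonempty : ∃ t ∈ Γ, t ∉ R₀
  free : ∀ x : V → Bool, (∀ j ∉ R₀, x j = x₀ j) → ∀ t ∈ Γ, t ∉ Q →
    (∀ j ∈ Γ, j ∉ Q → ¬ N.Par vt β x j t) →
    ∃ w : List V, (∀ i ∈ w, i ∈ Q) ∧ w.length ≤ α ∧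
      ∀ j ∈ Γ, ¬ N.Par vt β (N.map.act w x) j t

/-- The invariant of the flip lemma: outside `R`, only the vertices of `T` and `Λ` need not be
accounted for, and those of `Λ` are sinks that are accounted for once they have flipped. -/
structure FlipState (N : CanalizingNet V) (Γ R₀ Q : Finset V) (x₀ : V → Bool)
    (vt : V → V → Prop) (β : V → Bool) (R T Λ : Finset V) (x : V → Bool) : Prop where
  agree : ∀ j ∉ R₀, x j = x₀ j
  subset : Q ⊆ R
  subset' : R ⊆ R₀
  disj : ∀ t ∈ T, t ∉ R ∧ t ∈ Γ
  sink_subset : ∀ l ∈ Λ, l ∈ R₀ ∧ l ∉ R ∧ l ∈ Γ ∧ l ∉ T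
  par : ∀ b ∈ Γ, b ∉ R → b ∉ T → b ∉ Λ → ∃ j ∈ Γ, j ∉ R ∧ j ∉ Λ ∧ N.Par vt β x j b
  sink : ∀ l ∈ Λ, ∀ e ∈ R, l ∉ N.inputs e ∧ ¬ vt l e
  sink_par : ∀ l ∈ Λ, ∃ j ∈ Γ, j ∉ R ∧ j ∉ Λ ∧
    ∀ y : V → Bool, y j = x j → y l = !x l → N.Par vt β y j l

/-- The number of steps of the flip lemma. -/
def flipCost (α : ℕ) : ℕ → ℕ
  | 0 => α
  | 1 => 2 * α + 1
  | r + 2 => flipCost α (r + 1) + flipCost α r + 2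

theorem le_flipCost (α : ℕ) : ∀ r, α ≤ flipCost α r
  | 0 => le_rfl
  | 1 => by simp only [flipCost]; omega
  | r + 2 => by
    have := le_flipCost α r
    simp only [flipCost]; omega

theorem flipCost_succ (α r : ℕ) : flipCost α r + α + 1 ≤ flipCost α (r + 1) := by
  cases r with
  | zero => simp only [flipCost]; omega
  | succ r =>
    have := le_flipCost α r
    simp only [flipCost]; omega

theorem add_flipCost_le (α : ℕ) {f m r : ℕ} (h : f + m ≤ r) : f + flipCost α m ≤ flipCost α r := by
  induction r generalizing f with
  | zero =>
    obtain ⟨rfl, rfl⟩ : f = 0 ∧ m = 0 := by omega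
    simp
  | succ r ih =>
    have := flipCost_succ α r
    rcases Nat.eq_zero_or_pos f with rfl | hf
    · rcases Nat.lt_or_ge m (r + 1) with hm | hm
      · have := ih (f := 0) (by omega)
        omega
      · have : m = r + 1 := by omega
        simp [this]
    · have := ih (f := f - 1) (by omega)
      omega

variable {N : CanalizingNet V} {Γ R₀ Q : Finset V} {x₀ : V → Bool} {vt : V → V → Prop}
  {β : V → Bool} {α : ℕ}

/-- As long as R is not reduced, some vertex has its value decided from outside R. One update gives
it a consistent input outside R, so it can leave R, and each update is paid for by the loss of one
free vertex. The final clause, that R really shrinks when it is not reduced, is the source of the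
Fibonacci recursion. -/
theorem FlipState.closure (hF : FlipFrame N Γ R₀ Q x₀ vt β α) {T Λ : Finset V} :
    ∀ (n : ℕ) {R : Finset V} {x : V → Bool}, R.card = n → FlipState N Γ R₀ Q x₀ vt β R T Λ x →
    ∃ R' ⊆ R, ∃ w : List V, (∀ i ∈ w, i ∈ R) ∧ w.length + R'.card ≤ R.card ∧
      FlipState N Γ R₀ Q x₀ vt β R' T Λ (N.map.act w x) ∧ N.Reduced R' (N.map.act w x) ∧
      (¬ N.Reduced R x → R' ≠ R) := by
  intro n
  induction n with
  | zero =>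
    intro R x hR hS
    have hR' : R = ∅ := Finset.card_eq_zero.1 hR
    have hred : N.Reduced R x := fun e he => by simp [hR'] at he
    exact ⟨R, subset_rfl, [], by simp, by simp, hS, hred, fun h => absurd hred h⟩
  | succ n ih =>
    intro R x hR hS
    by_cases hred : N.Reduced R x
    · exact ⟨R, subset_rfl, [], by simp, by simp, hS, hred, fun h => absurd hred h⟩
    obtain ⟨e, he, j, hj, hjR, hcons⟩ := exists_forced hF.source hred
    -- The vertices of the input-closed set Q are never forced from outside.
    have heQ : e ∉ Q := fun h => hjR (hS.subset (hF.closed e h hj))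
    have hstep : ∀ k ∉ R, N.map.step e x k = x k := fun k hk =>
      BooleanNetwork.step_of_ne _ (ne_of_mem_of_not_mem he hk).symm x
    have hmem : ∀ k, k ∉ R.erase e → k ≠ e → k ∉ R := fun k hk hke h =>
      hk (Finset.mem_erase.2 ⟨hke, h⟩)
    have hS' : FlipState N Γ R₀ Q x₀ vt β (R.erase e) T Λ (N.map.step e x) := by
      refine ⟨fun k hk => ?_, fun k hk => ?_, fun k hk => ?_, fun t ht => ?_, fun l hl => ?_,
        fun b hb hbR hbT hbΛ => ?_, fun l hl k hk => ?_, fun l hl => ?_⟩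
      · rw [hstep k fun h => hk (hS.subset' h), hS.agree k hk]
      · exact Finset.mem_erase.2 ⟨fun h => heQ (h ▸ hk), hS.subset hk⟩
      · exact hS.subset' (Finset.mem_of_mem_erase hk)
      · exact ⟨fun h => (hS.disj t ht).1 (Finset.mem_of_mem_erase h), (hS.disj t ht).2⟩
      · obtain ⟨h1, h2, h3⟩ := hS.sink_subset l hl
        exact ⟨h1, fun h => h2 (Finset.mem_of_mem_erase h), h3⟩
      · by_cases hbe : b = e
        · subst hbe
          refine ⟨j, hF.inputs_subset b (hS.subset' he) hj,
            fun h => hjR (Finset.mem_of_mem_erase h), fun h => (hS.sink j h b he).1 hj,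
            Or.inl ⟨hj, hcons⟩⟩
        · have hbR' := hmem b hbR hbe
          obtain ⟨k, hk1, hk2, hk3, hk4⟩ := hS.par b hb hbR' hbT hbΛ
          exact ⟨k, hk1, fun h => hk2 (Finset.mem_of_mem_erase h), hk3,
            hk4.congr (hstep k hk2) (hstep b hbR')⟩
      · exact hS.sink l hl k (Finset.mem_of_mem_erase hk)
      · obtain ⟨k, hk1, hk2, hk3, hk4⟩ := hS.sink_par l hl
        refine ⟨k, hk1, fun h => hk2 (Finset.mem_of_mem_erase h), hk3, fun y hy hyl => ?_⟩
        exact hk4 y (by rw [hy, hstep k hk2]) (by rw [hyl, hstep l (hS.sink_subset l hl).2.1])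
    have hcard := Finset.card_erase_of_mem he
    obtain ⟨R', hR', w, hw, hlen, h1, h2, -⟩ := ih (by omega) hS'
    refine ⟨R', hR'.trans (Finset.erase_subset _ _), e :: w, ?_, ?_, h1, h2, ?_⟩
    · intro i hi
      rcases List.mem_cons.1 hi with rfl | hi
      · exact he
      · exact Finset.mem_of_mem_erase (hw i hi)
    · simp only [List.length_cons]
      omega
    · rintro - rfl
      exact Finset.notMem_erase e _ (hR' he)

/-- The conclusion of the flip lemma, with `r` free vertices outside `Q`. -/
def FlipGoal (N : CanalizingNet V) (Γ : Finset V) (vt : V → V → Prop) (β : V → Bool) (α r : ℕ)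
    (R T Λ : Finset V) (x : V → Bool) : Prop :=
  ∃ w : List V, (∀ i ∈ w, i ∈ R ∨ i ∈ Λ) ∧ ∃ Λ' ⊆ Λ, ∃ t ∈ T,
    (∀ j ∈ Γ, ¬ N.Par vt β (N.map.act w x) j t) ∧
    (∀ k, k ∉ R → (k ∈ Λ → k ∈ Λ') → N.map.act w x k = x k) ∧
    (∀ l ∈ Λ, l ∉ Λ' → N.map.act w x l = !x l) ∧
    w.length + (α + 1) * Λ'.card ≤ flipCost α r + (α + 1) * Λ.card

/-- With only Q left free, the absence of consistent cycles yields a vertex t that nothing outside Q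
accounts for, and `free` removes its consistent inputs in Q. By the invariant t is a target or a
deferred sink. In the second case flipping it makes it accounted for, at a cost of at most α + 1,
and the argument repeats with one sink fewer. -/
theorem FlipState.goal_zero (hF : FlipFrame N Γ R₀ Q x₀ vt β α) {T : Finset V} :
    ∀ (n : ℕ) {Λ : Finset V} {x : V → Bool}, Λ.card = n →
      FlipState N Γ R₀ Q x₀ vt β Q T Λ x → FlipGoal N Γ vt β α 0 Q T Λ x := by
  intro n
  induction n with
  | zero =>
    intro Λ x hΛ hS
    have hΛ' : Λ = ∅ := Finset.card_eq_zero.1 hΛ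
    subst hΛ'
    obtain ⟨t₀, ht₀, ht₀'⟩ := hF.nonempty
    obtain ⟨t, ht, htp⟩ := hF.root x hS.agree (Γ \ Q) Finset.sdiff_subset
      ⟨t₀, Finset.mem_sdiff.2 ⟨ht₀, fun h => ht₀' (hF.subset h)⟩⟩
    rw [Finset.mem_sdiff] at ht
    have htT : t ∈ T := by
      by_contra hT
      obtain ⟨j, hj1, hj2, -, hj4⟩ := hS.par t ht.1 ht.2 hT (by simp)
      exact htp j (Finset.mem_sdiff.2 ⟨hj1, hj2⟩) hj4
    obtain ⟨w, hw, hlen, hfree⟩ := hF.free x hS.agree t ht.1 ht.2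
      (fun j hj hjQ => htp j (Finset.mem_sdiff.2 ⟨hj, hjQ⟩))
    refine ⟨w, fun i hi => Or.inl (hw i hi), ∅, subset_rfl, t, htT, hfree, fun k hk _ => ?_,
      by simp, by simpa [flipCost] using hlen⟩
    exact BooleanNetwork.act_of_notMem _ (fun h => hk (hw k h)) x
  | succ n ih =>
    intro Λ x hΛ hS
    obtain ⟨t₀, ht₀, ht₀'⟩ := hF.nonempty
    obtain ⟨t, ht, htp⟩ := hF.root x hS.agree (Γ \ Q) Finset.sdiff_subset
      ⟨t₀, Finset.mem_sdiff.2 ⟨ht₀, fun h => ht₀' (hF.subset h)⟩⟩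
    rw [Finset.mem_sdiff] at ht
    obtain ⟨w, hw, hlen, hfree⟩ := hF.free x hS.agree t ht.1 ht.2
      (fun j hj hjQ => htp j (Finset.mem_sdiff.2 ⟨hj, hjQ⟩))
    have hact : ∀ k ∉ Q, N.map.act w x k = x k := fun k hk =>
      BooleanNetwork.act_of_notMem _ (fun h => hk (hw k h)) x
    by_cases htT : t ∈ T
    · refine ⟨w, fun i hi => Or.inl (hw i hi), Λ, subset_rfl, t, htT, hfree, fun k hk _ => hact k hk,
        fun l hl hl' => absurd hl hl', ?_⟩
      simp only [flipCost]
      omega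
    have htΛ : t ∈ Λ := by
      by_contra hΛt
      obtain ⟨j, hj1, hj2, -, hj4⟩ := hS.par t ht.1 ht.2 htT hΛt
      exact htp j (Finset.mem_sdiff.2 ⟨hj1, hj2⟩) hj4
    obtain ⟨htR₀, -, -, -⟩ := hS.sink_subset t htΛ
    have hflip : N.map (N.map.act w x) t = !(N.map.act w x) t :=
      map_eq_not_of_loose (hF.source t) fun j hj hc =>
        hfree j (hF.inputs_subset t htR₀ hj) (Or.inl ⟨hj, hc⟩)
    set x₂ := N.map.act (w ++ [t]) x with hx₂
    have hx₂t : x₂ t = !x t := by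
      rw [hx₂, BooleanNetwork.act_append, BooleanNetwork.act_cons, BooleanNetwork.act_nil,
        BooleanNetwork.step_self, hflip, hact t ht.2]
    have hx₂k : ∀ k, k ∉ Q → k ≠ t → x₂ k = x k := fun k hk hkt => by
      rw [hx₂, BooleanNetwork.act_append, BooleanNetwork.act_cons, BooleanNetwork.act_nil,
        BooleanNetwork.step_of_ne _ hkt, hact k hk]
    have hS' : FlipState N Γ R₀ Q x₀ vt β Q T (Λ.erase t) x₂ := by
      refine ⟨fun k hk => ?_, subset_rfl, hS.subset', hS.disj,
        fun l hl => hS.sink_subset l (Finset.mem_of_mem_erase hl), fun b hb hbR hbT hbΛ => ?_,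
        fun l hl k hk => hS.sink l (Finset.mem_of_mem_erase hl) k hk, fun l hl => ?_⟩
      · rw [hx₂k k (fun h => hk (hF.subset h)) (fun h => hk (h ▸ htR₀)), hS.agree k hk]
      · by_cases hbt : b = t
        · subst hbt
          obtain ⟨j, hj1, hj2, hj3, hj4⟩ := hS.sink_par b htΛ
          exact ⟨j, hj1, hj2, fun h => hj3 (Finset.mem_of_mem_erase h),
            hj4 _ (hx₂k j hj2 fun h => hj3 (h ▸ htΛ)) hx₂t⟩
        · have hbΛ' : b ∉ Λ := fun h => hbΛ (Finset.mem_erase.2 ⟨hbt, h⟩)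
          obtain ⟨j, hj1, hj2, hj3, hj4⟩ := hS.par b hb hbR hbT hbΛ'
          exact ⟨j, hj1, hj2, fun h => hj3 (Finset.mem_of_mem_erase h),
            hj4.congr (hx₂k j hj2 fun h => hj3 (h ▸ htΛ)) (hx₂k b hbR hbt)⟩
      · have hlΛ := Finset.mem_of_mem_erase hl
        obtain ⟨j, hj1, hj2, hj3, hj4⟩ := hS.sink_par l hlΛ
        refine ⟨j, hj1, hj2, fun h => hj3 (Finset.mem_of_mem_erase h), fun y hyj hyl => ?_⟩
        rw [hx₂k j hj2 fun h => hj3 (h ▸ htΛ)] at hyj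
        rw [hx₂k l (hS.sink_subset l hlΛ).2.1 (Finset.ne_of_mem_erase hl)] at hyl
        exact hj4 y hyj hyl
    have hcard := Finset.card_erase_of_mem htΛ
    obtain ⟨w', hw', Λ', hΛ', t', ht', hfree', hkeep, hflip', hlen'⟩ := ih (by omega) hS'
    refine ⟨w ++ [t] ++ w', ?_, Λ', hΛ'.trans (Finset.erase_subset _ _), t', ht', ?_, ?_, ?_, ?_⟩
    · intro i hi
      simp only [List.mem_append, List.mem_singleton] at hi
      rcases hi with (hi | rfl) | hi
      · exact Or.inl (hw i hi)
      · exact Or.inr htΛ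
      · exact (hw' i hi).imp id Finset.mem_of_mem_erase
    · rw [BooleanNetwork.act_append]
      exact hfree'
    · intro k hk hkΛ
      rw [BooleanNetwork.act_append, ← hx₂, hkeep k hk fun h => hkΛ (Finset.mem_of_mem_erase h)]
      refine hx₂k k hk fun h => ?_
      subst h
      exact Finset.notMem_erase _ _ (hΛ' (hkΛ htΛ))
    · intro l hl hl'
      rw [BooleanNetwork.act_append, ← hx₂]
      by_cases hlt : l = t
      · subst hlt
        rw [hkeep l (hS.sink_subset l hl).2.1 fun h => absurd h (Finset.notMem_erase _ _), hx₂t]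
      · rw [hflip' l (Finset.mem_erase.2 ⟨hlt, hl⟩) hl', hx₂k l (hS.sink_subset l hl).2.1 hlt]
    · simp only [List.length_append, List.length_singleton]
      have : (α + 1) * Λ.card = (α + 1) * (Λ.erase t).card + (α + 1) := by
        rw [show Λ.card = (Λ.erase t).card + 1 by omega]; ring
      simp only [flipCost] at hlen' ⊢
      omega

/-- Accounting for the two recursive calls: at least one of them has lost a second free vertex, and
single updates spent on closure are never dearer than free vertices. -/
theorem flipCost_split (α : ℕ) {r m₁ m₂ : ℕ} (h₁ : m₁ ≤ r + 1) (h₂ : m₂ ≤ r + 1)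
    (h : m₁ + m₂ < 2 * (r + 1)) :
    (r + 1 - m₁ + flipCost α m₁) + 1 + (r + 1 - m₂ + flipCost α m₂) ≤ flipCost α (r + 2) := by
  have e : flipCost α (r + 2) = flipCost α (r + 1) + flipCost α r + 2 := rfl
  have a₁ := add_flipCost_le α (show r + 1 - m₁ + m₁ ≤ r + 1 by omega)
  have a₂ := add_flipCost_le α (show r + 1 - m₂ + m₂ ≤ r + 1 by omega)
  rcases Nat.lt_or_ge m₁ (r + 1) with h' | h'
  · have := add_flipCost_le α (show r - m₁ + m₁ ≤ r by omega)
    omega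
  · have := add_flipCost_le α (show r - m₂ + m₂ ≤ r by omega)
    omega

/-- Induction on the number of free vertices outside Q. An entry e of R, with an outside vertex j
that can account for it, is removed from R. Depending on its value and on whether it feeds the rest
of R, it is kept, deferred to Λ, or made a temporary target and flipped. -/
theorem FlipState.goal (hF : FlipFrame N Γ R₀ Q x₀ vt β α) :
    ∀ (r : ℕ) {R T Λ : Finset V} {x : V → Bool}, (R \ Q).card = r → N.Reduced R x →
      FlipState N Γ R₀ Q x₀ vt β R T Λ x → FlipGoal N Γ vt β α r R T Λ x := by
  intro r
  induction r using Nat.strong_induction_on with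
  | _ r ih =>
  intro R T Λ x hr hred hS
  by_cases hRQ : R = Q
  · subst hRQ
    have : r = 0 := by rw [← hr]; simp
    subst this
    exact hS.goal_zero hF _ rfl
  obtain ⟨e, heR, heQ, j, hjΓ, hjR, hje⟩ := hF.entry R hS.subset hS.subset' hRQ
  have hjΛ : j ∉ Λ := fun h => hje.elim (hS.sink j h e heR).1 (hS.sink j h e heR).2
  have heR₀ := hS.subset' heR
  -- The value of e for which j accounts for it: `top e` for a real arc, since j is neutral by
  -- reducedness, and `β e` for a virtual one.
  obtain ⟨b, hb⟩ : ∃ b, ∀ y : V → Bool, y j = x j → y e = b → N.Par vt β y j e := by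
    rcases hje with h | h
    · refine ⟨N.top e, fun y hj he => Or.inl ⟨h, ?_⟩⟩
      unfold Cons
      rw [hj, he, (hred e heR).1 j h hjR]
      simp
    · exact ⟨β e, fun y _ he => Or.inr ⟨h, he⟩⟩
  have hcard : ((R.erase e) \ Q).card + 1 = r := by
    rw [← hr, Finset.erase_sdiff_comm, Finset.card_erase_add_one]
    exact Finset.mem_sdiff.2 ⟨heR, heQ⟩
  have hsub : ∀ {R'}, R' ⊆ R.erase e → ((R' \ Q).card : ℕ) < r := fun h => by
    have := Finset.card_le_card (Finset.sdiff_subset_sdiff h (subset_refl Q))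
    omega
  have hmem : ∀ k, k ∉ R.erase e → k ≠ e → k ∉ R := fun k hk hke h =>
    hk (Finset.mem_erase.2 ⟨hke, h⟩)
  have hQe : Q ⊆ R.erase e := fun k hk =>
    Finset.mem_erase.2 ⟨fun h => heQ (h ▸ hk), hS.subset hk⟩
  -- removing `e` from the free vertices, at a configuration that may differ from `x` on `R`
  -- and on flipped sinks
  have hrem : ∀ {T' Λ' : Finset V} {y : V → Bool}, Λ' ⊆ Λ → T ⊆ T' → T' ⊆ insert e T →
      (∀ k ∉ R, (k ∈ Λ → k ∈ Λ') → y k = x k) → (∀ l ∈ Λ, l ∉ Λ' → y l = !x l) →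
      (e ∈ T' ∨ y e = b) → FlipState N Γ R₀ Q x₀ vt β (R.erase e) T' Λ' y := by
    intro T' Λ' y hΛ' hTT' hT' hyk hyl hye
    have hyj : ∀ k ∉ R, k ∉ Λ → y k = x k := fun k hk hkΛ => hyk k hk fun h => absurd h hkΛ
    refine ⟨fun k hk => ?_, hQe, (Finset.erase_subset _ _).trans hS.subset', fun t ht => ?_,
      fun l hl => ?_, fun k hk hkR hkT hkΛ => ?_,
      fun l hl k hk => hS.sink l (hΛ' hl) k (Finset.mem_of_mem_erase hk), fun l hl => ?_⟩
    · rw [hyj k (fun h => hk (hS.subset' h)) (fun h => hk (hS.sink_subset k h).1), hS.agree k hk]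
    · rcases Finset.mem_insert.1 (hT' ht) with rfl | h
      · exact ⟨Finset.notMem_erase _ _, hF.subset' heR₀⟩
      · exact ⟨fun h' => (hS.disj t h).1 (Finset.mem_of_mem_erase h'), (hS.disj t h).2⟩
    · obtain ⟨h1, h2, h3, h4⟩ := hS.sink_subset l (hΛ' hl)
      refine ⟨h1, fun h => h2 (Finset.mem_of_mem_erase h), h3, fun h => ?_⟩
      rcases Finset.mem_insert.1 (hT' h) with rfl | h
      · exact h2 heR
      · exact h4 h
    · by_cases hke : k = e
      · subst hke
        refine ⟨j, hjΓ, fun h => hjR (Finset.mem_of_mem_erase h), fun h => hjΛ (hΛ' h), ?_⟩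
        rcases hye with h | h
        · exact absurd h hkT
        · exact hb y (hyj j hjR hjΛ) h
      · have hkR' := hmem k hkR hke
        by_cases hkΛ' : k ∈ Λ
        · obtain ⟨i, hi1, hi2, hi3, hi4⟩ := hS.sink_par k hkΛ'
          exact ⟨i, hi1, fun h => hi2 (Finset.mem_of_mem_erase h), fun h => hi3 (hΛ' h),
            hi4 y (hyj i hi2 hi3) (hyl k hkΛ' hkΛ)⟩
        · obtain ⟨i, hi1, hi2, hi3, hi4⟩ := hS.par k hk hkR' (fun h => hkT (hTT' h)) hkΛ'
          exact ⟨i, hi1, fun h => hi2 (Finset.mem_of_mem_erase h), fun h => hi3 (hΛ' h),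
            hi4.congr (hyj i hi2 hi3) (hyj k hkR' hkΛ')⟩
    · obtain ⟨i, hi1, hi2, hi3, hi4⟩ := hS.sink_par l (hΛ' hl)
      refine ⟨i, hi1, fun h => hi2 (Finset.mem_of_mem_erase h), fun h => hi3 (hΛ' h),
        fun z hzi hzl => hi4 z (by rw [hzi, hyj i hi2 hi3]) ?_⟩
      rw [hzl, hyk l (hS.sink_subset l (hΛ' hl)).2.1 fun _ => hl]
  -- closing the set of free vertices, and then the induction hypothesis
  have hgo : ∀ {T' Λ' : Finset V} {y : V → Bool},
      FlipState N Γ R₀ Q x₀ vt β (R.erase e) T' Λ' y →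
      ∃ m < r, (¬ N.Reduced (R.erase e) y → m + 1 < r) ∧ ∃ w : List V,
        (∀ i ∈ w, i ∈ R.erase e ∨ i ∈ Λ') ∧ ∃ Λ'' ⊆ Λ', ∃ t ∈ T',
        (∀ j ∈ Γ, ¬ N.Par vt β (N.map.act w y) j t) ∧
        (∀ k, k ∉ R.erase e → (k ∈ Λ' → k ∈ Λ'') → N.map.act w y k = y k) ∧
        (∀ l ∈ Λ', l ∉ Λ'' → N.map.act w y l = !y l) ∧
        w.length + (α + 1) * Λ''.card ≤ (r - 1 - m) + flipCost α m + (α + 1) * Λ'.card := by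
    intro T' Λ' y hy
    obtain ⟨R', hR', w, hw, hlen, hS', hred', hne⟩ := hy.closure hF _ rfl
    obtain ⟨w', hw', Λ'', hΛ'', t, ht, hfree, hkeep, hflip, hlen'⟩ :=
      ih _ (hsub hR') rfl hred' hS'
    have hQR' := hS'.subset
    have c1 := Finset.card_sdiff_add_card_eq_card hQR'
    have c2 := Finset.card_sdiff_add_card_eq_card hQe
    have hact : ∀ k ∉ R.erase e, N.map.act w y k = y k := fun k hk =>
      BooleanNetwork.act_of_notMem _ (fun h => hk (hw k h)) y
    refine ⟨_, hsub hR', fun h => ?_, w ++ w', ?_, Λ'', hΛ'', t, ht, ?_, ?_, ?_, ?_⟩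
    · have := Finset.card_lt_card (hR'.ssubset_of_ne (hne h))
      omega
    · intro i hi
      rcases List.mem_append.1 hi with hi | hi
      · exact Or.inl (hw i hi)
      · exact (hw' i hi).imp (fun h => hR' h) id
    · rwa [BooleanNetwork.act_append]
    · intro k hk hkΛ
      rw [BooleanNetwork.act_append, hkeep k (fun h => hk (hR' h)) hkΛ, hact k hk]
    · intro l hl hl'
      rw [BooleanNetwork.act_append, hflip l hl hl', hact l (hy.sink_subset l hl).2.1]
    · rw [List.length_append]
      have := Finset.card_le_card hR'
      omega
  by_cases hxe : x e = b
  · obtain ⟨m, hm, -, w, hw, Λ', hΛ', t, ht, hfree, hkeep, hflip, hlen⟩ :=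
      hgo (hrem (subset_refl Λ) (subset_refl T) (Finset.subset_insert e T) (fun k _ _ => rfl)
        (fun l hl hl' => absurd hl hl') (Or.inr hxe))
    have := add_flipCost_le α (show r - 1 - m + m ≤ r by omega)
    exact ⟨w, fun i hi => (hw i hi).imp Finset.mem_of_mem_erase id, Λ', hΛ', t, ht, hfree,
      fun k hk => hkeep k fun h => hk (Finset.mem_of_mem_erase h), hflip, by omega⟩
  have hnot : ∀ {c : Bool}, c = !x e → c = b := by
    intro c hc
    cases hxe' : x e <;> cases b <;> simp_all
  -- If e feeds no vertex of R other than itself, its value is irrelevant there, so its flip is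
  -- deferred and a single recursive call suffices.
  by_cases hsink : ∀ k ∈ R.erase e, e ∉ N.inputs k
  · have hS' : FlipState N Γ R₀ Q x₀ vt β (R.erase e) T (insert e Λ) x := by
      refine ⟨hS.agree, hQe, (Finset.erase_subset _ _).trans hS.subset',
        fun t ht => ⟨fun h' => (hS.disj t ht).1 (Finset.mem_of_mem_erase h'), (hS.disj t ht).2⟩,
        fun l hl => ?_, fun k hk hkR hkT hkΛ => ?_, fun l hl k hk => ?_, fun l hl => ?_⟩
      · rcases Finset.mem_insert.1 hl with rfl | hl
        · exact ⟨heR₀, Finset.notMem_erase _ _, hF.subset' heR₀, fun h => (hS.disj l h).1 heR⟩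
        · obtain ⟨h1, h2, h3⟩ := hS.sink_subset l hl
          exact ⟨h1, fun h => h2 (Finset.mem_of_mem_erase h), h3⟩
      · have hke : k ≠ e := fun h => hkΛ (h ▸ Finset.mem_insert_self _ _)
        obtain ⟨i, hi1, hi2, hi3, hi4⟩ := hS.par k hk (hmem k hkR hke) hkT
          fun h => hkΛ (Finset.mem_insert_of_mem h)
        refine ⟨i, hi1, fun h => hi2 (Finset.mem_of_mem_erase h), fun h => ?_, hi4⟩
        rcases Finset.mem_insert.1 h with rfl | h
        exacts [hi2 heR, hi3 h]
      · rcases Finset.mem_insert.1 hl with rfl | hl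
        · exact ⟨hsink k hk, fun h => hF.vt_notMem _ _ h heR₀⟩
        · exact hS.sink l hl k (Finset.mem_of_mem_erase hk)
      · rcases Finset.mem_insert.1 hl with rfl | hl
        · refine ⟨j, hjΓ, fun h => hjR (Finset.mem_of_mem_erase h), fun h => ?_,
            fun y hy hyl => hb y hy (hnot hyl)⟩
          rcases Finset.mem_insert.1 h with rfl | h
          exacts [hjR heR, hjΛ h]
        · obtain ⟨i, hi1, hi2, hi3, hi4⟩ := hS.sink_par l hl
          refine ⟨i, hi1, fun h => hi2 (Finset.mem_of_mem_erase h), fun h => ?_, hi4⟩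
          rcases Finset.mem_insert.1 h with rfl | h
          exacts [hi2 heR, hi3 h]
    have hred' : N.Reduced (R.erase e) x := by
      intro k hk
      obtain ⟨h1, i, hi, hiR⟩ := hred k (Finset.mem_of_mem_erase hk)
      refine ⟨fun i hi hiR => h1 i hi (hmem i hiR fun h => hsink k hk (h ▸ hi)), i, hi, ?_⟩
      exact Finset.mem_erase.2 ⟨fun h => hsink k hk (h ▸ hi), hiR⟩
    obtain ⟨w, hw, Λ', hΛ', t, ht, hfree, hkeep, hflip, hlen⟩ :=
      ih _ (hsub subset_rfl) rfl hred' hS'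
    have heΛ : e ∉ Λ := fun h => (hS.sink_subset e h).2.1 heR
    refine ⟨w, fun i hi => ?_, Λ'.erase e, fun k hk => ?_, t, ht, hfree, fun k hk hkΛ => ?_,
      fun l hl hl' => ?_, ?_⟩
    · rcases hw i hi with h | h
      · exact Or.inl (Finset.mem_of_mem_erase h)
      · exact (Finset.mem_insert.1 h).imp (fun h' : i = e => h' ▸ heR) id
    · exact (Finset.mem_insert.1 (hΛ' (Finset.mem_of_mem_erase hk))).resolve_left
        (Finset.ne_of_mem_erase hk)
    · refine hkeep k (fun h => hk (Finset.mem_of_mem_erase h)) fun h => ?_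
      exact Finset.mem_of_mem_erase
        (hkΛ ((Finset.mem_insert.1 h).resolve_left (ne_of_mem_of_not_mem heR hk).symm))
    · exact hflip l (Finset.mem_insert_of_mem hl) fun h =>
        hl' (Finset.mem_erase.2 ⟨ne_of_mem_of_not_mem hl heΛ, h⟩)
    · rw [Finset.card_insert_of_notMem heΛ] at hlen
      have h1 := Nat.mul_le_mul_left (α + 1) (Finset.card_erase_le (s := Λ') (a := e))
      -- The α + 1 reserved for the new sink is the increment of `flipCost` for one more free
      -- vertex.
      have h2 := flipCost_succ α (r - 1)
      rw [show r - 1 + 1 = r by omega] at h2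
      rw [show ((R.erase e) \ Q).card = r - 1 by omega, mul_add, mul_one] at hlen
      omega
  push Not at hsink
  obtain ⟨k, hk, hek⟩ := hsink
  have hr2 : 2 ≤ r := by
    have : k ∈ (R.erase e) \ Q := by
      refine Finset.mem_sdiff.2 ⟨hk, fun h => heQ (hF.closed k h hek)⟩
    have := Finset.card_pos.2 ⟨k, this⟩
    omega
  -- e has the wrong value and feeds k. The first call takes e as an additional target; if e itself
  -- becomes loose it is flipped, and the second call has the original targets only.
  obtain ⟨m₁, hm₁, hm₁', w₁, hw₁, Λ₁, hΛ₁, t, ht, hfree, hkeep, hflip, hlen⟩ :=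
    hgo (hrem (subset_refl Λ) (Finset.subset_insert e T) (subset_refl _) (fun k _ _ => rfl)
      (fun l hl hl' => absurd hl hl') (Or.inl (Finset.mem_insert_self e T)))
  have hw₁' : ∀ i ∈ w₁, i ∈ R ∨ i ∈ Λ := fun i hi => (hw₁ i hi).imp Finset.mem_of_mem_erase id
  have hkeep' : ∀ k ∉ R, (k ∈ Λ → k ∈ Λ₁) → N.map.act w₁ x k = x k := fun k hk hkΛ =>
    hkeep k (fun h => hk (Finset.mem_of_mem_erase h)) hkΛ
  by_cases htT : t ∈ T
  · have := add_flipCost_le α (show r - 1 - m₁ + m₁ ≤ r by omega)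
    exact ⟨w₁, hw₁', Λ₁, hΛ₁, t, htT, hfree, hkeep', hflip, by omega⟩
  obtain rfl : t = e := (Finset.mem_insert.1 ht).resolve_right htT
  have hte : N.map.act w₁ x t = x t :=
    hkeep t (Finset.notMem_erase _ _) fun h => absurd heR (hS.sink_subset t h).2.1
  have hmap : N.map (N.map.act w₁ x) t = !(N.map.act w₁ x t) :=
    map_eq_not_of_loose (hF.source t) fun i hi hc =>
      hfree i (hF.inputs_subset t heR₀ hi) (Or.inl ⟨hi, hc⟩)
  set y := N.map.act (w₁ ++ [t]) x with hy
  have hyt : y t = !x t := by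
    rw [hy, BooleanNetwork.act_append, BooleanNetwork.act_cons, BooleanNetwork.act_nil,
      BooleanNetwork.step_self, hmap, hte]
  have hyk : ∀ k, k ≠ t → y k = N.map.act w₁ x k := fun k hkt => by
    rw [hy, BooleanNetwork.act_append, BooleanNetwork.act_cons, BooleanNetwork.act_nil,
      BooleanNetwork.step_of_ne _ hkt]
  have hyR : ∀ k ∉ R, (k ∈ Λ → k ∈ Λ₁) → y k = x k := fun k hk hkΛ => by
    rw [hyk k (ne_of_mem_of_not_mem heR hk).symm, hkeep' k hk hkΛ]
  have hyΛ : ∀ l ∈ Λ, l ∉ Λ₁ → y l = !x l := fun l hl hl' => by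
    rw [hyk l (ne_of_mem_of_not_mem heR (hS.sink_subset l hl).2.1).symm, hflip l hl hl']
  obtain ⟨m₂, hm₂, hm₂', w₂, hw₂, Λ₂, hΛ₂, t', ht', hfree', hkeep₂, hflip₂, hlen₂⟩ :=
    hgo (hrem hΛ₁ (subset_refl T) (Finset.subset_insert t T) hyR hyΛ (Or.inr (hnot hyt)))
  -- The two calls see opposite values of e. One of these is not neutral for k, so in that call the
  -- set `R.erase e` is not reduced and closure removes another vertex.
  have hsplit : m₁ + 1 < r ∨ m₂ + 1 < r := by
    by_cases hn : x t = N.lit t k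
    · refine Or.inr (hm₂' fun h => ?_)
      have := (h k hk).1 t hek (Finset.notMem_erase _ _)
      rw [hyt, hn] at this
      simp at this
    · exact Or.inl (hm₁' fun h => hn ((h k hk).1 t hek (Finset.notMem_erase _ _)))
  refine ⟨w₁ ++ [t] ++ w₂, fun i hi => ?_, Λ₂, hΛ₂.trans hΛ₁, t', ht', ?_, fun k hk hkΛ => ?_,
    fun l hl hl' => ?_, ?_⟩
  · simp only [List.mem_append, List.mem_singleton] at hi
    rcases hi with (hi | rfl) | hi
    · exact hw₁' i hi
    · exact Or.inl heR
    · exact (hw₂ i hi).imp Finset.mem_of_mem_erase fun h => hΛ₁ h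
  · rwa [BooleanNetwork.act_append]
  · rw [BooleanNetwork.act_append, ← hy,
      hkeep₂ k (fun h => hk (Finset.mem_of_mem_erase h)) fun h => hkΛ (hΛ₁ h),
      hyR k hk fun h => hΛ₂ (hkΛ h)]
  · rw [BooleanNetwork.act_append, ← hy]
    by_cases hl₁ : l ∈ Λ₁
    · rw [hflip₂ l hl₁ hl', hyR l (hS.sink_subset l hl).2.1 fun _ => hl₁]
    · rw [hkeep₂ l (fun h => (hS.sink_subset l hl).2.1 (Finset.mem_of_mem_erase h))
        fun h => absurd h hl₁, hyΛ l hl hl₁]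
  · simp only [List.length_append, List.length_singleton]
    obtain ⟨r, rfl⟩ : ∃ q, r = q + 2 := ⟨r - 2, by omega⟩
    have := flipCost_split α (r := r) (m₁ := m₁) (m₂ := m₂) (by omega) (by omega) (by omega)
    rw [show r + 2 - 1 = r + 1 by omega] at hlen hlen₂
    omega

end CanalizingNet

/-! ### Making a vertex loose: the Fibonacci bound. -/

namespace CanalizingNet

open Nat (fib)

variable {V : Type*}

theorem flipCost_add_two (α : ℕ) : ∀ r, flipCost α r + 2 = α * fib (r + 2) + fib (r + 3)
  | 0 => by simp [flipCost, Nat.fib_add_two]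
  | 1 => by simp [flipCost, Nat.fib_add_two]; ring
  | r + 2 => by
    have h1 := flipCost_add_two α r
    have h2 := flipCost_add_two α (r + 1)
    have e1 : fib (r + 4) = fib (r + 2) + fib (r + 3) := Nat.fib_add_two
    have e2 : fib (r + 5) = fib (r + 3) + fib (r + 4) := Nat.fib_add_two
    simp only [flipCost]
    rw [show r + 2 + 2 = r + 4 by ring, show r + 2 + 3 = r + 5 by ring, e2, e1]
    rw [show r + 1 + 2 = r + 3 by ring, show r + 1 + 3 = r + 4 by ring, e1] at h2
    linarith

/-- The addition formula for Fibonacci numbers bounds the nested cost in terms of q + r alone, so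
the way R splits into its core and the remainder does not matter. -/
theorem flipCost_fib_le (q r : ℕ) :
    flipCost (flipCost 0 q) r + 2 ≤ 2 * fib (q + r + 2) := by
  have h1 := flipCost_add_two 0 q
  have h2 := flipCost_add_two (flipCost 0 q) r
  have e1 : fib (q + r + 2) = fib q * fib (r + 1) + fib (q + 1) * fib (r + 2) := by
    rw [← Nat.fib_add]; rfl
  have e2 : fib (q + 3) = 2 * fib (q + 1) + fib q := by
    rw [Nat.fib_add_two (n := q + 1), Nat.fib_add_two (n := q)]; ring
  have e3 : fib (r + 2) = fib r + fib (r + 1) := Nat.fib_add_two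
  have e4 : fib (r + 3) = fib (r + 1) + fib (r + 2) := Nat.fib_add_two
  have h3 : fib r ≤ fib (r + 1) := Nat.fib_le_fib_succ
  have h4 : flipCost 0 q + 2 = 2 * fib (q + 1) + fib q := by rw [h1, e2]; ring
  have h5 := Nat.mul_le_mul_left (fib q) h3
  have h6 : (flipCost 0 q + 2) * fib (r + 2) = (2 * fib (q + 1) + fib q) * fib (r + 2) := by
    rw [h4]
  rw [h2, e1]
  nlinarith

/-- The homogeneity of a net, in the form in which the flip lemma uses it: if no arc enters `Q`, then
virtual arcs from `t` make all the vertices of `Q` accessible from `t` without creating a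
consistent cycle. -/
def VirtuallyAccessible (N : CanalizingNet V) : Prop :=
  ∀ (t : V) (Q : Finset V), t ∉ Q → (∀ e ∈ Q, N.inputs e ⊆ Q) → ∀ a : Bool,
    ∃ (J : Finset V) (β : V → Bool),
      (∀ y : V → Bool, y t = a → ∀ S : Finset V, (∀ b ∈ S, b = t ∨ b ∈ Q) → S.Nonempty →
        ∃ b ∈ S, ∀ j ∈ S, ¬ N.Par (fun j e => j = t ∧ e ∈ J) β y j b) ∧
      ∀ R ⊆ Q, R.Nonempty → ∃ e ∈ R, (∃ j ∈ Q, j ∉ R ∧ j ∈ N.inputs e) ∨ e ∈ J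

variable [DecidableEq V] {N : CanalizingNet V}

/-- The inputs of `t` in an input-closed set can be made inconsistent. -/
theorem exists_loose_of_closed (hs : ∀ i, (N.inputs i).Nonempty) (hv : N.VirtuallyAccessible)
    {t : V} {Q : Finset V} (ht : t ∉ Q) (hQ : ∀ e ∈ Q, N.inputs e ⊆ Q) (x : V → Bool) :
    ∃ w : List V, (∀ i ∈ w, i ∈ Q) ∧ w.length ≤ flipCost 0 Q.card ∧
      ∀ j ∈ N.inputs t, j ∈ Q → ¬ N.Cons (N.map.act w x) j t := by
  obtain ⟨J, β, h1, h2⟩ := hv t Q ht hQ (x t)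
  -- The flip lemma at the inner level: all of Q is free, the inner closed set is empty (whence α =
  -- 0), and the virtual arcs from t supply the entries that Q lacks.
  have hF : FlipFrame N (insert t Q) Q ∅ x (fun j e => j = t ∧ e ∈ J) β 0 := by
    refine ⟨hs, fun y hy S hS hne => h1 y (hy t ht) S (fun b hb => by simpa using hS hb) hne,
      fun R _ hR hne => ?_, ?_, Finset.empty_subset _, by simp, fun e he => ?_,
      Finset.subset_insert _ _, ⟨t, Finset.mem_insert_self _ _, ht⟩, ?_⟩
    · obtain ⟨e, he, h⟩ := h2 R hR (Finset.nonempty_iff_ne_empty.2 hne)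
      refine ⟨e, he, Finset.notMem_empty e, ?_⟩
      rcases h with ⟨j, hj, hjR, hje⟩ | h
      · exact ⟨j, Finset.mem_insert_of_mem hj, hjR, Or.inl hje⟩
      · exact ⟨t, Finset.mem_insert_self _ _, fun h' => ht (hR h'), Or.inr ⟨rfl, h⟩⟩
    · rintro j b ⟨rfl, -⟩
      exact ht
    · exact (hQ e he).trans (Finset.subset_insert _ _)
    · intro y _ s _ _ h
      exact ⟨[], by simp, le_rfl, fun j hj => h j hj (Finset.notMem_empty j)⟩
  have hS : FlipState N (insert t Q) Q ∅ x (fun j e => j = t ∧ e ∈ J) β Q {t} ∅ x := by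
    refine ⟨fun _ _ => rfl, Finset.empty_subset _, subset_rfl, ?_, by simp, ?_, by simp, by simp⟩
    · simp [ht]
    · intro b hb hbQ hbt
      simp only [Finset.mem_insert] at hb
      simp at hbt
      tauto
  have hred : N.Reduced Q x := fun e he =>
    ⟨fun j hj hjQ => absurd (hQ e he hj) hjQ, (hs e).imp fun j hj => ⟨hj, hQ e he hj⟩⟩
  obtain ⟨w, hw, Λ', hΛ', s, hs', hfree, -, -, hlen⟩ :=
    hS.goal hF (Q \ ∅).card rfl hred
  simp only [Finset.mem_singleton] at hs'
  subst hs'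
  simp only [Finset.sdiff_empty, Finset.card_empty, mul_zero, add_zero] at hlen
  refine ⟨w, fun i hi => (hw i hi).resolve_right (Finset.notMem_empty i), by omega, ?_⟩
  exact fun j hj hjQ hc => hfree j (Finset.mem_insert_of_mem hjQ) (Or.inl ⟨hj, hc⟩)

/-- The largest input-closed subset of `R`. -/
def core [Fintype V] (N : CanalizingNet V) (R : Finset V) : Finset V :=
  (R.powerset.filter fun C => ∀ e ∈ C, N.inputs e ⊆ C).biUnion id

theorem mem_core [Fintype V] {R : Finset V} {v : V} :
    v ∈ N.core R ↔ ∃ C ⊆ R, (∀ e ∈ C, N.inputs e ⊆ C) ∧ v ∈ C := by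
  simp [core, and_assoc]

/-- If `R` is reduced, then, by updating the vertices of `R` only, one of the vertices outside `R`
without consistent input outside `R` loses all its consistent inputs. -/
theorem exists_loose [Fintype V] (hs : ∀ i, (N.inputs i).Nonempty) (hv : N.VirtuallyAccessible)
    (hc : N.NoConsistentCycle) {R T : Finset V} {x : V → Bool} (hne : ∃ v, v ∉ R)
    (hred : N.Reduced R x) (hT : ∀ t ∈ T, t ∉ R)
    (hp : ∀ b ∉ R, b ∉ T → ∃ j ∈ N.inputs b, j ∉ R ∧ N.Cons x j b) :
    ∃ w : List V, (∀ i ∈ w, i ∈ R) ∧ w.length + 2 ≤ 2 * fib (R.card + 2) ∧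
      ∃ t ∈ T, ∀ j ∈ N.inputs t, ¬ N.Cons (N.map.act w x) j t := by
  set Q := N.core R with hQdef
  have hQR : Q ⊆ R := fun v hv => by
    obtain ⟨C, hC, -, hvC⟩ := mem_core.1 hv
    exact hC hvC
  have hQ : ∀ e ∈ Q, N.inputs e ⊆ Q := fun e he j hj => by
    obtain ⟨C, hC, hC', heC⟩ := mem_core.1 he
    exact mem_core.2 ⟨C, hC, hC', hC' e heC hj⟩
  have hpar : ∀ {y : V → Bool} {j b : V}, N.Par (fun _ _ => False) (fun _ => true) y j b ↔
      j ∈ N.inputs b ∧ N.Cons y j b := by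
    intro y j b
    simp [Par]
  -- The outer level has no virtual arcs; its base cost α is the cost of the inner level on the
  -- core.
  have hF : FlipFrame N Finset.univ R Q x (fun _ _ => False) (fun _ => true)
      (flipCost 0 Q.card) := by
    refine ⟨hs, fun y _ S _ hS => ?_, fun R' hQR' hR' hne' => ?_, fun _ _ h => h.elim, hQR, hQ,
      fun _ _ => Finset.subset_univ _, Finset.subset_univ _, ?_, fun y _ t _ htQ h => ?_⟩
    · obtain ⟨b, hb, h⟩ := hc y S hS
      exact ⟨b, hb, fun j hj hjb => h j hj (hpar.1 hjb).1 (hpar.1 hjb).2⟩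
    -- Without an entry outside the core, R' would be input-closed, hence contained in the core.
    · by_contra! hcon
      refine hne' (subset_antisymm (fun v hvR' => mem_core.2 ⟨R', hR', fun e he j hj => ?_, hvR'⟩)
        hQR')
      by_cases heQ : e ∈ Q
      · exact hQR' (hQ e heQ hj)
      · by_contra hjR'
        exact (hcon e he heQ j (Finset.mem_univ j) hjR').1 hj
    · obtain ⟨v, hv⟩ := hne
      exact ⟨v, Finset.mem_univ v, hv⟩
    · obtain ⟨w, hw, hlen, hw'⟩ := exists_loose_of_closed hs hv htQ hQ y
      refine ⟨w, hw, hlen, fun j _ hj => ?_⟩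
      rw [hpar] at hj
      by_cases hjQ : j ∈ Q
      · exact hw' j hj.1 hjQ hj.2
      · have hact : ∀ k ∉ Q, N.map.act w y k = y k := fun k hk =>
          BooleanNetwork.act_of_notMem _ (fun h => hk (hw k h)) y
        exact h j (Finset.mem_univ j) hjQ
          (hpar.2 ⟨hj.1, hj.2.congr (hact j hjQ).symm (hact t htQ).symm⟩)
  have hS : FlipState N Finset.univ R Q x (fun _ _ => False) (fun _ => true) R T ∅ x := by
    refine ⟨fun _ _ => rfl, hQR, subset_rfl, fun t ht => ⟨hT t ht, Finset.mem_univ t⟩, by simp,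
      fun b _ hbR hbT _ => ?_, by simp, by simp⟩
    obtain ⟨j, hj, hjR, hjc⟩ := hp b hbR hbT
    exact ⟨j, Finset.mem_univ j, hjR, Finset.notMem_empty j, hpar.2 ⟨hj, hjc⟩⟩
  obtain ⟨w, hw, Λ', hΛ', t, ht, hfree, -, -, hlen⟩ := hS.goal hF (R \ Q).card rfl hred
  simp only [Finset.card_empty, mul_zero, add_zero] at hlen
  refine ⟨w, fun i hi => (hw i hi).resolve_right (Finset.notMem_empty i), ?_, t, ht,
    fun j hj hc => hfree j (Finset.mem_univ j) (hpar.2 ⟨hj, hc⟩)⟩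
  have h1 := flipCost_fib_le Q.card (R \ Q).card
  have h2 := Finset.card_sdiff_add_card_eq_card hQR
  rw [show Q.card + (R \ Q).card + 2 = R.card + 2 by omega] at h1
  omega

end CanalizingNet

/-! ### Bringing two configurations closer, or rigidity of their difference. -/

namespace CanalizingNet

variable {V : Type*} {N : CanalizingNet V}

theorem Acyc.mono {S S' : Finset V} (h : N.Acyc S) (hS : S' ⊆ S) : N.Acyc S' :=
  fun W hW hne => h W (hW.trans hS) hne

theorem eq_lit_of_map_eq_top {x : V → Bool} {i j : V} (h : N.map x i = N.top i)
    (hj : j ∈ N.inputs i) : x j = N.lit j i := by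
  by_contra hn
  rw [map_eq_not_top hj hn] at h
  simp at h

/-- On an acyclic set, stable values are determined by the values outside: the vertices of
disagreement would include one with no input among them. -/
theorem Acyc.eq_of_stable {S : Finset V} (hA : N.Acyc S) {p q : V → Bool}
    (hp : ∀ b ∈ S, N.map p b = p b) (hq : ∀ b ∈ S, N.map q b = q b) (h : ∀ b ∉ S, p b = q b) :
    p = q := by
  by_contra hpq
  obtain ⟨c, hc⟩ := Function.ne_iff.1 hpq
  have hcS : c ∈ S := by_contra fun h' => hc (h c h')
  obtain ⟨b, hb, hbi⟩ := hA (S.filter fun b => p b ≠ q b) (Finset.filter_subset _ _)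
    ⟨c, Finset.mem_filter.2 ⟨hcS, hc⟩⟩
  rw [Finset.mem_filter] at hb
  refine hb.2 ?_
  rw [← hp b hb.1, ← hq b hb.1]
  refine map_congr fun j hj => ?_
  by_contra hn
  exact hbi j (Finset.mem_filter.2 ⟨by_contra fun h' => hn (h j h'), hn⟩) hj

/-- When two images differ, one of them is `top b`, so every input on which the configurations
differ has the literal value in exactly the configuration whose image is `top b`. All differing
inputs therefore act in unison, which is what a fork contradicts after a flip. -/
theorem map_eq_top_iff_of_ne {x y : V → Bool} {b j : V} (h : N.map x b ≠ N.map y b)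
    (hj : j ∈ N.inputs b) (hd : x j ≠ y j) : N.map x b = N.top b ↔ x j = N.lit j b := by
  refine ⟨fun h' => eq_lit_of_map_eq_top h' hj, fun h' => ?_⟩
  by_contra hn
  have : N.map y b = N.top b := by
    cases hx : N.map x b <;> cases hy : N.map y b <;> cases ht : N.top b <;> simp_all
  exact hd (h'.trans (eq_lit_of_map_eq_top this hj).symm)

theorem eq_lit_of_ne {x y : V → Bool} {b j : V} (h : N.map x b ≠ N.map y b)
    (hj : j ∈ N.inputs b) (hd : x j = y j) : x j = N.lit j b := by
  by_cases hx : N.map x b = N.top b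
  · exact eq_lit_of_map_eq_top hx hj
  · have : N.map y b = N.top b := by
      cases hx' : N.map x b <;> cases hy : N.map y b <;> cases ht : N.top b <;> simp_all
    rw [hd]
    exact eq_lit_of_map_eq_top this hj

theorem exists_input_of_ne {x y : V → Bool} {b : V} (h : N.map x b ≠ N.map y b) :
    ∃ j ∈ N.inputs b, x j ≠ y j := by
  by_contra! hc
  exact h (map_congr hc)

theorem map_eq_iff_cons {x y : V → Bool} {b j : V} (h : N.map x b ≠ N.map y b)
    (hj : j ∈ N.inputs b) (hd : x j ≠ y j) : N.map x b = x b ↔ N.Cons x j b := by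
  have h1 := map_eq_top_iff_of_ne h hj hd
  unfold Cons
  cases hx : N.map x b <;> cases ht : N.top b <;> cases hb : x b <;> simp_all

/-- `g` can be reached backwards in `k` steps, inside `D`, from a vertex of `D` that is one of at least
two inputs in `D` of a vertex of `D`. -/
def NearFork (N : CanalizingNet V) (D : Finset V) : ℕ → V → Prop
  | 0, g => g ∈ D ∧ ∃ b ∈ D, g ∈ N.inputs b ∧ ∃ g' ∈ D, g' ∈ N.inputs b ∧ g' ≠ g
  | k + 1, g => g ∈ D ∧ ∃ b ∈ D, g ∈ N.inputs b ∧ NearFork N D k b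

theorem NearFork.mem {D : Finset V} : ∀ {k : ℕ} {g : V}, N.NearFork D k g → g ∈ D
  | 0, _, h => h.1
  | _ + 1, _, h => h.1

section

variable [DecidableEq V]

/-- An acyclic set can be stabilized by updating each of its vertices once. -/
theorem Acyc.exists_stabilizing : ∀ (n : ℕ) {S : Finset V}, S.card = n → N.Acyc S →
    ∃ l : List V, (∀ i ∈ l, i ∈ S) ∧ l.length = S.card ∧
      ∀ x, ∀ b ∈ S, N.map (N.map.act l x) b = N.map.act l x b := by
  intro n
  induction n with
  | zero =>
    intro S hS _
    rw [Finset.card_eq_zero] at hS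
    subst hS
    exact ⟨[], by simp⟩
  | succ n ih =>
    intro S hS hA
    obtain ⟨b, hb, hbi⟩ := hA S subset_rfl (Finset.card_pos.1 (by omega))
    have hcard := Finset.card_erase_add_one hb
    obtain ⟨l, hl, hlen, hst⟩ := ih (S := S.erase b) (by omega) (hA.mono (Finset.erase_subset _ _))
    refine ⟨b :: l, fun i hi => ?_, by simp [hlen, hcard], fun x c hc => ?_⟩
    · rcases List.mem_cons.1 hi with rfl | hi
      exacts [hb, Finset.mem_of_mem_erase (hl i hi)]
    · rw [BooleanNetwork.act_cons]
      by_cases hcb : c = b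
      · subst hcb
        have hc : c ∉ l := fun h => Finset.notMem_erase _ _ (hl c h)
        rw [BooleanNetwork.act_of_notMem _ hc, BooleanNetwork.step_self]
        refine map_congr fun j hj => ?_
        have hjS : j ∉ S := fun h => hbi j h hj
        rw [BooleanNetwork.act_of_notMem _ fun h => hjS (Finset.mem_of_mem_erase (hl j h)),
          BooleanNetwork.step_of_ne _ (ne_of_mem_of_not_mem hb hjS).symm]
      · exact hst _ c (Finset.mem_erase.2 ⟨hcb, hc⟩)

/-- The later vertices of a shortest route to a fork form an acyclic set: a vertex with a second
input in D would be a shorter way to a fork. This bounds the length of the route by the size of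
acyclic sets. -/
theorem NearFork.exists_acyc {D : Finset V} : ∀ {k : ℕ} {g : V}, N.NearFork D k g →
    (∀ i < k, ¬ N.NearFork D i g) →
    ∃ S ⊆ D, S.card = k ∧ N.Acyc S ∧ ∀ v ∈ S, ∃ i < k, N.NearFork D i v
  | 0, _, _, _ => ⟨∅, by simp, by simp, fun W hW hne => by simp_all, by simp⟩
  | k + 1, g, ⟨hg, b, hb, hgb, hk⟩, hmin => by
    have hbmin : ∀ i < k, ¬ N.NearFork D i b := fun i hi hbi =>
      hmin (i + 1) (by omega) ⟨hg, b, hb, hgb, hbi⟩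
    obtain ⟨S, hSD, hcard, hA, hS⟩ := hk.exists_acyc hbmin
    have hbS : b ∉ S := fun h => by
      obtain ⟨i, hi, h'⟩ := hS b h
      exact hbmin i hi h'
    refine ⟨insert b S, ?_, by rw [Finset.card_insert_of_notMem hbS, hcard], ?_, ?_⟩
    · exact Finset.insert_subset hb hSD
    · intro W hW hne
      by_cases hbW : b ∈ W
      · refine ⟨b, hbW, fun j hj hjb => ?_⟩
        have hjg : j = g := by
          by_contra hjg
          refine hmin 0 (by omega) ⟨hg, b, hb, hgb, j, ?_, hjb, hjg⟩
          exact Finset.insert_subset hb hSD (hW hj)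
        subst hjg
        rcases Finset.mem_insert.1 (hW hj) with rfl | h
        · exact hmin k (by omega) hk
        · obtain ⟨i, hi, h'⟩ := hS j h
          exact hmin i (by omega) h'
      · exact hA W (fun v hv => (Finset.mem_insert.1 (hW hv)).resolve_left
          (ne_of_mem_of_not_mem hv hbW)) hne
    · intro v hv
      rcases Finset.mem_insert.1 hv with rfl | hv
      · exact ⟨k, by omega, hk⟩
      · obtain ⟨i, hi, h'⟩ := hS v hv
        exact ⟨i, by omega, h'⟩

end

variable [Fintype V]

/-- The set of components on which two configurations differ. -/
def diff (x y : V → Bool) : Finset V := Finset.univ.filter fun i => x i ≠ y i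

theorem mem_diff {x y : V → Bool} {i : V} : i ∈ diff x y ↔ x i ≠ y i := by simp [diff]

theorem notMem_diff {x y : V → Bool} {i : V} : i ∉ diff x y ↔ x i = y i := by simp [diff]

variable [DecidableEq V]

theorem diff_step_erase {x y : V → Bool} {b : V} (h : N.map x b = N.map y b) :
    diff (N.map.step b x) (N.map.step b y) = (diff x y).erase b := by
  ext i
  rw [Finset.mem_erase, mem_diff, mem_diff]
  by_cases hi : i = b
  · subst hi; simp [BooleanNetwork.step_self, h]
  · simp [BooleanNetwork.step_of_ne _ hi, hi]

theorem diff_step_of_ne {x y : V → Bool} {b : V} (h : N.map x b ≠ N.map y b) :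
    diff (N.map.step b x) (N.map.step b y) = insert b (diff x y) := by
  ext i
  rw [Finset.mem_insert, mem_diff, mem_diff]
  by_cases hi : i = b
  · subst hi; simp [BooleanNetwork.step_self, h]
  · simp [BooleanNetwork.step_of_ne _ hi, hi]

theorem diff_step_ssubset {x y : V → Bool} {b : V} (hb : b ∈ diff x y)
    (h : N.map x b = N.map y b) :
    diff (N.map.step b x) (N.map.step b y) ⊂ diff x y := by
  rw [diff_step_erase h]
  exact Finset.erase_ssubset hb

/-- Instability travels along the route: if b is stable, the arc from g to b is consistent, and
flipping g destroys this, so b becomes unstable unless its two images already coincide. At the fork,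
flipping one of the two inputs makes the images coincide. -/
theorem NearFork.shrink {D : Finset V} : ∀ {k : ℕ} {g : V} {x y : V → Bool}, diff x y = D →
    N.NearFork D k g → N.map x g ≠ x g →
    ∃ w : List V, w.length ≤ k + 2 ∧ diff (N.map.act w x) (N.map.act w y) ⊂ D := by
  intro k
  induction k with
  | zero =>
    rintro g x y rfl ⟨hg, b, hb, hgb, g', hg', hgb', hne⟩ hun
    by_cases halt : ∀ b ∈ diff x y, N.map x b ≠ N.map y b
    · refine ⟨[g, b], by simp, ?_⟩
      have hd : diff (N.map.step g x) (N.map.step g y) = diff x y := by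
        rw [diff_step_of_ne (halt g hg), Finset.insert_eq_of_mem hg]
      rw [← hd]
      refine diff_step_ssubset (hd ▸ hb) ?_
      -- The inputs g and g' of b agreed as to whether they have their literal values; only g has
      -- flipped, so they no longer do.
      by_contra hc
      have h1 := map_eq_top_iff_of_ne hc hgb (mem_diff.1 (hd ▸ hg))
      have h2 := map_eq_top_iff_of_ne hc hgb' (mem_diff.1 (hd ▸ hg'))
      have h3 := map_eq_top_iff_of_ne (halt b hb) hgb (mem_diff.1 hg)
      have h4 := map_eq_top_iff_of_ne (halt b hb) hgb' (mem_diff.1 hg')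
      rw [h2, BooleanNetwork.step_of_ne _ hne, BooleanNetwork.step_self, ← h4, h3] at h1
      cases hx : x g <;> cases hx' : N.map x g <;> cases hl : N.lit g b <;> simp_all
    · push Not at halt
      obtain ⟨c, hc, he⟩ := halt
      exact ⟨[c], by simp, diff_step_ssubset hc he⟩
  | succ k ih =>
    rintro g x y rfl ⟨hg, b, hb, hgb, hk⟩ hun
    by_cases halt : ∀ b ∈ diff x y, N.map x b ≠ N.map y b
    · by_cases hbun : N.map x b ≠ x b
      · obtain ⟨w, hw, h⟩ := ih rfl hk hbun
        exact ⟨w, by omega, h⟩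
      · push Not at hbun
        have hbg : b ≠ g := fun h => hun (h ▸ hbun)
        have hd : diff (N.map.step g x) (N.map.step g y) = diff x y := by
          rw [diff_step_of_ne (halt g hg), Finset.insert_eq_of_mem hg]
        by_cases hc : N.map (N.map.step g x) b = N.map (N.map.step g y) b
        · refine ⟨[g, b], by simp, ?_⟩
          rw [← hd]
          exact diff_step_ssubset (hd ▸ hb) hc
        · have h1 := map_eq_iff_cons hc hgb (mem_diff.1 (hd ▸ hg))
          have h2 := map_eq_iff_cons (halt b hb) hgb (mem_diff.1 hg)
          obtain ⟨w, hw, h⟩ := ih hd hk (fun h => by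
            rw [h1] at h
            rw [h2] at hbun
            unfold Cons at h hbun
            rw [BooleanNetwork.step_self, BooleanNetwork.step_of_ne _ hbg] at h
            cases hx : x g <;> cases hx' : N.map x g <;> cases hl : N.lit g b <;> simp_all)
          exact ⟨g :: w, by simp only [List.length_cons]; omega, h⟩
    · push Not at halt
      obtain ⟨c, hc, he⟩ := halt
      exact ⟨[c], by simp, diff_step_ssubset hc he⟩

/-- In `x`, each vertex `b` of `D` has a unique input `π b` in `D`, and its inputs outside `D` are
neutral. -/
def Rigid (N : CanalizingNet V) (D : Finset V) (π : V → V) (x : V → Bool) : Prop :=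
  ∀ b ∈ D, π b ∈ D ∧ π b ∈ N.inputs b ∧ (∀ j ∈ N.inputs b, j ∈ D → j = π b) ∧
    ∀ j ∈ N.inputs b, j ∉ D → x j = N.lit j b

/-- Either two configurations can be brought closer in `s + 2` steps, where `s` bounds the size of
acyclic sets, or the set on which they differ is rigid. -/
theorem shrink_or_rigid (hc : N.NoConsistentCycle) {s : ℕ} (hs : ∀ S, N.Acyc S → S.card ≤ s)
    (x y : V → Bool) :
    (∃ w : List V, w.length ≤ s + 2 ∧ diff (N.map.act w x) (N.map.act w y) ⊂ diff x y) ∨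
      ∃ π, N.Rigid (diff x y) π x := by
  by_cases halt : ∀ b ∈ diff x y, N.map x b ≠ N.map y b
  swap
  · push Not at halt
    obtain ⟨c, hc, he⟩ := halt
    exact Or.inl ⟨[c], by simp, diff_step_ssubset hc he⟩
  have hin : ∀ b ∈ diff x y, ∃ p ∈ diff x y, p ∈ N.inputs b := fun b hb => by
    obtain ⟨j, hj, h⟩ := exists_input_of_ne (halt b hb)
    exact ⟨j, mem_diff.2 h, hj⟩
  by_cases hfork : ∃ g, N.NearFork (diff x y) 0 g
  · classical
    left
    obtain ⟨g, hg⟩ := hfork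
    -- The vertices of D leading to a fork contain all their predecessors in D. One without
    -- consistent input among them is thus unstable, since every vertex of D has an input in D.
    obtain ⟨b, hb, hbc⟩ := hc x ((diff x y).filter fun v => ∃ k, N.NearFork (diff x y) k v)
      ⟨g, Finset.mem_filter.2 ⟨hg.mem, 0, hg⟩⟩
    obtain ⟨hbD, hE⟩ := Finset.mem_filter.1 hb
    obtain ⟨p, hpD, hp⟩ := hin b hbD
    have hpW : ∃ k, N.NearFork (diff x y) k p := by
      obtain ⟨k, hk⟩ := hE
      exact ⟨k + 1, hpD, b, hbD, hp, hk⟩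
    have hun : N.map x b ≠ x b := by
      rw [Ne, map_eq_iff_cons (halt b hbD) hp (mem_diff.1 hpD)]
      exact hbc p (Finset.mem_filter.2 ⟨hpD, hpW⟩) hp
    obtain ⟨S, -, hcard, hA, -⟩ := (Nat.find_spec hE).exists_acyc fun i hi => Nat.find_min hE hi
    have := hs S hA
    obtain ⟨w, hw, h⟩ := (Nat.find_spec hE).shrink rfl hun
    exact ⟨w, by omega, h⟩
  · right
    choose! π hπ using hin
    refine ⟨π, fun b hb => ⟨(hπ b hb).1, (hπ b hb).2, fun j hj hjD => ?_, fun j hj hjD =>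
      eq_lit_of_ne (halt b hb) hj (notMem_diff.1 hjD)⟩⟩
    by_contra hne
    exact hfork ⟨π b, (hπ b hb).1, b, hb, (hπ b hb).2, j, hjD, hj, hne⟩

end CanalizingNet

/-! ### Rigid difference sets, entry sets and priming. -/

namespace CanalizingNet

variable {V : Type*} {N : CanalizingNet V}

/-- No initial strong component is a cycle. -/
def NoInitialCycle (N : CanalizingNet V) : Prop :=
  ∀ C : Finset V, C.Nonempty → ¬ ∀ b ∈ C, ∃ p ∈ C, N.inputs b = {p}

section Rigid

variable {D : Finset V} {π : V → V} {x : V → Bool}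

theorem Rigid.congr {x' : V → Bool} (h : N.Rigid D π x) (hx : ∀ k ∉ D, x' k = x k) :
    N.Rigid D π x' := fun b hb =>
  ⟨(h b hb).1, (h b hb).2.1, (h b hb).2.2.1, fun j hj hjD =>
    (hx j hjD).trans ((h b hb).2.2.2 j hj hjD)⟩

theorem Rigid.map_eq_top_iff (h : N.Rigid D π x) {b : V} (hb : b ∈ D) :
    N.map x b = N.top b ↔ x (π b) = N.lit (π b) b := by
  obtain ⟨-, h2, h3, h4⟩ := h b hb
  refine ⟨fun h' => eq_lit_of_map_eq_top h' h2, fun h' => map_eq_top fun j hj => ?_⟩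
  by_cases hjD : j ∈ D
  · rw [h3 j hj hjD, h']
  · exact h4 j hj hjD

theorem Rigid.map_eq_iff (h : N.Rigid D π x) {b : V} (hb : b ∈ D) :
    N.map x b = x b ↔ N.Cons x (π b) b := by
  have := h.map_eq_top_iff hb
  unfold Cons
  rw [← this]
  cases N.map x b <;> cases x b <;> cases N.top b <;> simp

/-- The vertices of `U` are entries of `D` that cut all the cycles of `D`, each of them being the only
vertex of `U` on some cycle. -/
structure EntrySet (N : CanalizingNet V) [DecidableEq V] (D U : Finset V) (π : V → V) : Prop where
  subset : U ⊆ D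
  acyc : N.Acyc (D \ U)
  entry : ∀ v ∈ U, ∃ j ∈ N.inputs v, j ∉ D
  cycle : ∀ v ∈ U, ∃ W ⊆ D, v ∈ W ∧ (∀ b ∈ W, π b ∈ W) ∧ ∀ u ∈ W, u ∈ U → u = v

variable [DecidableEq V]

/-- Follow π backwards from u. If no vertex of this orbit had an input outside D, each would have
its π-predecessor as only input, which `NoInitialCycle` forbids. -/
theorem Rigid.exists_entry (hni : N.NoInitialCycle) (h : N.Rigid D π x) {u : V} (hu : u ∈ D) :
    ∃ v ∈ D, (∃ j ∈ N.inputs v, j ∉ D) ∧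
      ∀ W ⊆ D, (∀ b ∈ W, π b ∈ W) → u ∈ W → v ∈ W := by
  classical
  set C := D.filter fun v => ∀ W ⊆ D, (∀ b ∈ W, π b ∈ W) → u ∈ W → v ∈ W with hC
  have hCπ : ∀ b ∈ C, π b ∈ C := fun b hb => by
    rw [hC, Finset.mem_filter] at hb ⊢
    exact ⟨(h b hb.1).1, fun W hW hWπ huW => hWπ b (hb.2 W hW hWπ huW)⟩
  have hne : C.Nonempty := ⟨u, Finset.mem_filter.2 ⟨hu, fun W _ _ h => h⟩⟩
  by_contra! hcon
  refine hni C hne fun b hb => ⟨π b, hCπ b hb, ?_⟩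
  obtain ⟨hbD, hbW⟩ := Finset.mem_filter.1 hb
  obtain ⟨-, h2, h3, -⟩ := h b hbD
  ext j
  rw [Finset.mem_singleton]
  refine ⟨fun hj => h3 j hj ?_, fun hj => hj ▸ h2⟩
  by_contra hjD
  obtain ⟨W, hW, hWπ, huW, hbW'⟩ := hcon b hbD ⟨j, hj, hjD⟩
  exact hbW' (hbW W hW hWπ huW)

theorem Rigid.acyc_iff (h : N.Rigid D π x) {S : Finset V} (hS : S ⊆ D) :
    N.Acyc S ↔ ∀ W ⊆ S, (∀ b ∈ W, π b ∈ W) → W = ∅ := by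
  constructor
  · intro hA W hW hπ
    by_contra hne
    obtain ⟨b, hb, hb'⟩ := hA W hW (Finset.nonempty_iff_ne_empty.2 hne)
    exact hb' _ (hπ b hb) (h b (hS (hW hb))).2.1
  · intro hA W hW hne
    by_contra! hcon
    refine hne.ne_empty (hA W hW fun b hb => ?_)
    obtain ⟨j, hj, hjb⟩ := hcon b hb
    rwa [← (h b (hS (hW hb))).2.2.1 j hjb (hS (hW hj))]

/-- Moving each vertex of U₀ backwards along π to an entry preserves the cutting property, because
every π-closed set containing the vertex contains the entry as well. In a set of minimum size,
removing v must free some π-closed set, and this set meets U in v only. -/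
theorem Rigid.exists_entrySet (hni : N.NoInitialCycle) (h : N.Rigid D π x) {U₀ : Finset V}
    (hU₀ : U₀ ⊆ D) (hA : N.Acyc (D \ U₀)) :
    ∃ U, N.EntrySet D U π ∧ U.card ≤ U₀.card := by
  classical
  set 𝒰 := D.powerset.filter fun U => N.Acyc (D \ U) ∧ ∀ v ∈ U, ∃ j ∈ N.inputs v, j ∉ D with h𝒰
  have hmem : ∀ {U}, U ∈ 𝒰 ↔ U ⊆ D ∧ N.Acyc (D \ U) ∧ ∀ v ∈ U, ∃ j ∈ N.inputs v, j ∉ D := by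
    intro U
    rw [h𝒰, Finset.mem_filter, Finset.mem_powerset]
  choose! ρ hρ using fun u (hu : u ∈ D) => h.exists_entry hni hu
  have h₁ : U₀.image ρ ∈ 𝒰 := by
    refine hmem.2 ⟨?_, ?_, ?_⟩
    · intro v hv
      obtain ⟨u, hu, rfl⟩ := Finset.mem_image.1 hv
      exact (hρ u (hU₀ hu)).1
    · rw [h.acyc_iff Finset.sdiff_subset]
      intro W hW hπ
      refine (h.acyc_iff Finset.sdiff_subset).1 hA W (fun u hu => ?_) hπ
      have huD := (Finset.mem_sdiff.1 (hW hu)).1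
      refine Finset.mem_sdiff.2 ⟨huD, fun huU => ?_⟩
      have := (hρ u huD).2.2 W (hW.trans Finset.sdiff_subset) hπ hu
      exact (Finset.mem_sdiff.1 (hW this)).2 (Finset.mem_image_of_mem ρ huU)
    · intro v hv
      obtain ⟨u, hu, rfl⟩ := Finset.mem_image.1 hv
      exact (hρ u (hU₀ hu)).2.1
  obtain ⟨U, hU, hmin⟩ := Finset.exists_min_image 𝒰 Finset.card ⟨_, h₁⟩
  obtain ⟨hUD, hUA, hUe⟩ := hmem.1 hU
  refine ⟨U, ⟨hUD, hUA, hUe, fun v hv => ?_⟩, (hmin _ h₁).trans Finset.card_image_le⟩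
  have hlt := Finset.card_erase_lt_of_mem hv
  have hn : ¬ N.Acyc (D \ U.erase v) := fun hA' => by
    have := hmin (U.erase v) (hmem.2 ⟨(Finset.erase_subset _ _).trans hUD, hA', fun u hu =>
      hUe u (Finset.mem_of_mem_erase hu)⟩)
    omega
  rw [h.acyc_iff Finset.sdiff_subset] at hn
  push Not at hn
  obtain ⟨W, hW, hπ, hne⟩ := hn
  have huv : ∀ u ∈ W, u ∈ U → u = v := fun u hu huU => by
    by_contra huv
    exact (Finset.mem_sdiff.1 (hW hu)).2 (Finset.mem_erase.2 ⟨huv, huU⟩)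
  refine ⟨W, hW.trans Finset.sdiff_subset, ?_, hπ, huv⟩
  by_contra hvW
  refine hne.ne_empty ((h.acyc_iff Finset.sdiff_subset).1 hUA W (fun u hu => ?_) hπ)
  refine Finset.mem_sdiff.2 ⟨(Finset.mem_sdiff.1 (hW hu)).1, fun huU => hvW ?_⟩
  rwa [← huv u hu huU]

/-- If v were consistent with π v, all arcs of the π-closed set through v would be consistent. -/
theorem EntrySet.not_cons (hc : N.NoConsistentCycle) (h : N.Rigid D π x) {U : Finset V}
    (hU : N.EntrySet D U π) (hcons : ∀ b ∈ D, b ∉ U → N.Cons x (π b) b) {v : V} (hv : v ∈ U) :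
    ¬ N.Cons x (π v) v := by
  obtain ⟨W, hW, hvW, hπ, huv⟩ := hU.cycle v hv
  obtain ⟨b, hb, hb'⟩ := hc x W ⟨v, hvW⟩
  have := hb' (π b) (hπ b hb) (h b (hW hb)).2.1
  by_cases hbU : b ∈ U
  · rwa [← huv b hb hbU]
  · exact absurd (hcons b (hW hb) hbU) this

end Rigid

variable [DecidableEq V]

/-- Vertices that are not inputs of one another can be updated one by one with the effect of a
simultaneous update. -/
theorem act_eq_map_of_nodup : ∀ {r : List V} {x : V → Bool}, r.Nodup →
    (∀ v ∈ r, ∀ j ∈ N.inputs v, j ∈ r → j = v) → ∀ v ∈ r, N.map.act r x v = N.map x v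
  | [], _, _, _ => by simp
  | a :: r, x, hr, h => by
    intro v hv
    rw [List.nodup_cons] at hr
    rw [BooleanNetwork.act_cons]
    by_cases hva : v = a
    · subst hva
      rw [BooleanNetwork.act_of_notMem _ hr.1, BooleanNetwork.step_self]
    · have hv' := (List.mem_cons.1 hv).resolve_left hva
      rw [act_eq_map_of_nodup hr.2 (fun u hu j hj hjr => h u (List.mem_cons_of_mem _ hu) j hj
        (List.mem_cons_of_mem _ hjr)) v hv']
      refine map_congr fun j hj => BooleanNetwork.step_of_ne _ (fun hja => ?_) _
      subst hja
      exact hva (h v hv j hj List.mem_cons_self).symm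

variable [Fintype V]

/-- As outside inputs are neutral, the image of b copies or negates the value of π b, on which x and
y differ. Updates inside D thus preserve the difference set. -/
theorem Rigid.diff_act {π : V → V} : ∀ {w : List V} {x y : V → Bool}, N.Rigid (diff x y) π x →
    (∀ i ∈ w, i ∈ diff x y) → diff (N.map.act w x) (N.map.act w y) = diff x y
  | [], _, _, _, _ => rfl
  | b :: w, x, y, h, hw => by
    have hb := hw b List.mem_cons_self
    have hy : N.Rigid (diff x y) π y := h.congr fun k hk => (notMem_diff.1 hk).symm
    have hne : N.map x b ≠ N.map y b := fun he => by
      have h1 := h.map_eq_top_iff hb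
      have h2 := hy.map_eq_top_iff hb
      have h3 := mem_diff.1 (h b hb).1
      rw [← he, h1] at h2
      cases hx' : x (π b) <;> cases hy' : y (π b) <;> cases hl : N.lit (π b) b <;> simp_all
    have hd : diff (N.map.step b x) (N.map.step b y) = diff x y := by
      rw [diff_step_of_ne hne, Finset.insert_eq_of_mem hb]
    have h' : N.Rigid (diff (N.map.step b x) (N.map.step b y)) π (N.map.step b x) := by
      rw [hd]
      exact h.congr fun k hk => BooleanNetwork.step_of_ne _ (ne_of_mem_of_not_mem hb hk).symm x
    rw [BooleanNetwork.act_cons, BooleanNetwork.act_cons,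
      Rigid.diff_act h' fun i hi => by rw [hd]; exact hw i (List.mem_cons_of_mem _ hi), hd]

/-- The configuration of the pair from which the vertices outside `D` can be infected. -/
structure Primed (N : CanalizingNet V) (D U : Finset V) (π : V → V) (x : V → Bool) : Prop where
  cons : ∀ b ∈ D, b ∉ U → N.Cons x (π b) b
  root : ∀ v ∈ U, x v = N.top v
  not_cons : ∀ v ∈ U, ¬ N.Cons x (π v) v

/-- Stabilizing D \ U makes its arcs consistent, so that every vertex of U is unstable; updating
those with the wrong value corrects them, and a second stabilization restores consistency without
touching U. -/
theorem EntrySet.exists_primed (hc : N.NoConsistentCycle) {π : V → V} {x y : V → Bool}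
    (h : N.Rigid (diff x y) π x) {U : Finset V} (hU : N.EntrySet (diff x y) U π) :
    ∃ w : List V, (∀ i ∈ w, i ∈ diff x y) ∧ w.length ≤ 2 * (diff x y \ U).card + U.card ∧
      N.Primed (diff x y) U π (N.map.act w x) := by
  obtain ⟨l, hl, hlen, hst⟩ := hU.acyc.exists_stabilizing _ rfl
  set D := diff x y
  have hlD : ∀ i ∈ l, i ∈ D := fun i hi => (Finset.mem_sdiff.1 (hl i hi)).1
  have hlU : ∀ v ∈ U, v ∉ l := fun v hv h => (Finset.mem_sdiff.1 (hl v h)).2 hv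
  have hrig : ∀ {w : List V} {z : V → Bool}, N.Rigid D π z → (∀ i ∈ w, i ∈ D) →
      N.Rigid D π (N.map.act w z) := fun hz hw =>
    hz.congr fun k hk => BooleanNetwork.act_of_notMem _ (fun h => hk (hw k h)) _
  have hcons : ∀ {z : V → Bool}, N.Rigid D π z →
      ∀ b ∈ D, b ∉ U → N.Cons (N.map.act l z) (π b) b := fun hz b hb hbU =>
    ((hrig hz hlD).map_eq_iff hb).1 (hst _ b (Finset.mem_sdiff.2 ⟨hb, hbU⟩))
  set x₁ := N.map.act l x with hx₁
  have h₁ : N.Rigid D π x₁ := hrig h hlD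
  set r := (U.filter fun v => x₁ v ≠ N.top v).toList with hr
  have hrmem : ∀ v, v ∈ r ↔ v ∈ U ∧ x₁ v ≠ N.top v := fun v => by
    rw [hr, Finset.mem_toList, Finset.mem_filter]
  have hrD : ∀ i ∈ r, i ∈ D := fun i hi => hU.subset ((hrmem i).1 hi).1
  set x₂ := N.map.act r x₁ with hx₂
  have h₂ : N.Rigid D π x₂ := hrig h₁ hrD
  have hroot : ∀ v ∈ U, x₂ v = N.top v := fun v hv => by
    by_cases hvr : v ∈ r
    · have hne := ((hrmem v).1 hvr).2
      rw [hx₂, act_eq_map_of_nodup (Finset.nodup_toList _) (fun u hu j hj hjr => ?_) v hvr]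
      · have := (h₁.map_eq_iff (hU.subset hv)).not.2 (hU.not_cons hc h₁ (hcons h) hv)
        cases hx : N.map x₁ v <;> cases hx' : x₁ v <;> cases ht : N.top v <;> simp_all
      · obtain ⟨W, hW, huW, hπ, huniq⟩ := hU.cycle u ((hrmem u).1 hu).1
        have : j = π u := (h u (hrD u hu)).2.2.1 j hj (hrD j hjr)
        exact huniq j (this ▸ hπ u huW) ((hrmem j).1 hjr).1
    · have : x₁ v = N.top v := by
        by_contra hne
        exact hvr ((hrmem v).2 ⟨hv, hne⟩)
      rw [hx₂, BooleanNetwork.act_of_notMem _ hvr, this]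
  refine ⟨l ++ r ++ l, fun i hi => ?_, ?_, ?_⟩
  · simp only [List.mem_append] at hi
    rcases hi with (hi | hi) | hi
    exacts [hlD i hi, hrD i hi, hlD i hi]
  · simp only [List.length_append, hlen]
    have : r.length ≤ U.card := by
      rw [hr, Finset.length_toList]
      exact Finset.card_filter_le _ _
    omega
  · rw [BooleanNetwork.act_append, BooleanNetwork.act_append, ← hx₁, ← hx₂]
    refine ⟨hcons h₂, fun v hv => ?_, fun v hv => hU.not_cons hc (hrig h₂ hlD) (hcons h₂) hv⟩
    rw [BooleanNetwork.act_of_notMem _ (hlU v hv), hroot v hv]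

end CanalizingNet

/-! ### Spreading the difference: the infection phase. -/

namespace CanalizingNet

open Nat (fib)

variable {V : Type*} {N : CanalizingNet V}

theorem add_two_mul_fib_le {f h k : ℕ} (hk : f + h ≤ k) :
    f + 2 * fib (h + 2) ≤ 2 * fib (k + 2) := by
  induction f generalizing h with
  | zero =>
    have := Nat.fib_mono (show h + 2 ≤ k + 2 by omega)
    omega
  | succ f ih =>
    have h1 := ih (h := h + 1) (by omega)
    have h2 : fib (h + 3) = fib (h + 1) + fib (h + 2) := Nat.fib_add_two
    have h3 : 0 < fib (h + 1) := Nat.fib_pos.2 (by omega)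
    rw [show h + 1 + 2 = h + 3 by ring] at h1
    omega

/-- The number of steps of the infection phase when `k` vertices can be infected. -/
def phaseCost (k : ℕ) : ℕ := 2 * fib (k + 3) - 3 - k

theorem phaseCost_add (k : ℕ) : phaseCost k + 3 + k = 2 * fib (k + 3) := by
  have : 3 + k ≤ 2 * fib (k + 3) := by
    have := add_two_mul_fib_le (f := k) (h := 1) (k := k + 1) (by omega)
    have h3 : fib 3 = 2 := rfl
    rw [show k + 1 + 2 = k + 3 by ring, show 1 + 2 = 3 by rfl, h3] at this
    omega
  unfold phaseCost
  omega

theorem phaseCost_succ (k : ℕ) : phaseCost (k + 1) + 1 = phaseCost k + 2 * fib (k + 2) := by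
  have h1 := phaseCost_add k
  have h2 := phaseCost_add (k + 1)
  have h3 : fib (k + 4) = fib (k + 2) + fib (k + 3) := Nat.fib_add_two
  rw [show k + 1 + 3 = k + 4 by ring] at h2
  omega

theorem phaseCost_mono : Monotone phaseCost := monotone_nat_of_le_succ fun k => by
  have h1 := phaseCost_succ k
  have h2 : 0 < fib (k + 2) := Nat.fib_pos.2 (by omega)
  omega

theorem le_phaseCost (k : ℕ) : 2 * fib (k + 2) ≤ phaseCost k + 2 := by
  induction k with
  | zero => decide
  | succ k ih =>
    have h1 := phaseCost_succ k
    have h2 : fib (k + 3) = fib (k + 1) + fib (k + 2) := Nat.fib_add_two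
    have h3 : fib (k + 1) ≤ fib (k + 2) := Nat.fib_le_fib_succ
    have h4 := phaseCost_add k
    have h5 := add_two_mul_fib_le (f := k) (h := 0) (k := k) (by omega)
    rw [show k + 1 + 2 = k + 3 by ring]
    rw [zero_add, Nat.fib_two] at h5
    omega

theorem Primed.congr {D U : Finset V} {π : V → V} {x x' z : V → Bool} (hz : N.Rigid D π z)
    (hU : U ⊆ D) (h : N.Primed D U π x) (hx : ∀ i ∈ D, x' i = x i) : N.Primed D U π x' :=
  ⟨fun b hb hbU => (h.cons b hb hbU).congr (hx _ (hz b hb).1) (hx b hb),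
    fun v hv => (hx v (hU hv)).trans (h.root v hv),
    fun v hv hc => h.not_cons v hv
      (hc.congr (hx _ (hz v (hU hv)).1).symm (hx v (hU hv)).symm)⟩

/-- The infection, which starts from `D₀`, has reached the vertices on which `x` and `y` differ; it
cannot reach those of `B` any more. -/
structure Spread (N : CanalizingNet V) (D₀ B : Finset V) (x y : V → Bool) : Prop where
  subset : ∀ b ∈ D₀, x b ≠ y b
  disj : ∀ b ∈ B, x b = y b
  par : ∀ b, x b ≠ y b → b ∉ D₀ → ∃ d ∈ N.inputs b, x d ≠ y d ∧ N.Cons x d b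
  stable : ∀ b, x b ≠ y b → b ∉ D₀ →
    (y b = !N.top b ∧ ∃ d ∈ N.inputs b, x d ≠ y d ∧ y d ≠ N.lit d b) ∨
      (y b = N.top b ∧ ∀ d ∈ N.inputs b, x d ≠ y d ∧ y d = N.lit d b)
  parB : ∀ b ∈ B, ∃ d ∈ N.inputs b, x d ≠ y d ∧ N.Cons x d b

section

variable [DecidableEq V]

/-- Infecting a new vertex `t`. -/
theorem Spread.infect {D₀ B : Finset V} {x y : V → Bool} (h : N.Spread D₀ B x y) {t : V}
    (htB : t ∉ B) (ht : x t = y t) (hy : N.map y t = y t) (hx : N.map x t = !x t)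
    (hp : ∃ d ∈ N.inputs t, x d ≠ y d ∧ ¬ N.Cons x d t)
    (hst : (y t = !N.top t ∧ ∃ d ∈ N.inputs t, x d ≠ y d ∧ y d ≠ N.lit d t) ∨
      (y t = N.top t ∧ ∀ d ∈ N.inputs t, x d ≠ y d ∧ y d = N.lit d t)) :
    N.Spread D₀ B (N.map.step t x) y := by
  have hxt : N.map.step t x t = !x t := by rw [BooleanNetwork.step_self, hx]
  have hxi : ∀ i, i ≠ t → N.map.step t x i = x i := fun i hi => BooleanNetwork.step_of_ne _ hi x
  have hne : ∀ {i}, x i ≠ y i → i ≠ t := fun hi hit => hi (hit ▸ ht)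
  have hmono : ∀ {i}, x i ≠ y i → N.map.step t x i ≠ y i := fun hi => by rwa [hxi _ (hne hi)]
  refine ⟨fun b hb => hmono (h.subset b hb), fun b hb => ?_, fun b hb hbD => ?_,
    fun b hb hbD => ?_, fun b hb => ?_⟩
  · rw [hxi b (ne_of_mem_of_not_mem hb htB), h.disj b hb]
  · by_cases hbt : b = t
    · subst hbt
      obtain ⟨d, hd1, hd2, hd3⟩ := hp
      exact ⟨d, hd1, hmono hd2, Cons.of_flip hd3 (hxi d (hne hd2)) hxt⟩
    · rw [hxi b hbt] at hb
      obtain ⟨d, hd1, hd2, hd3⟩ := h.par b hb hbD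
      exact ⟨d, hd1, hmono hd2, hd3.congr (hxi d (hne hd2)) (hxi b hbt)⟩
  · have : (y b = !N.top b ∧ ∃ d ∈ N.inputs b, x d ≠ y d ∧ y d ≠ N.lit d b) ∨
        (y b = N.top b ∧ ∀ d ∈ N.inputs b, x d ≠ y d ∧ y d = N.lit d b) := by
      by_cases hbt : b = t
      · exact hbt ▸ hst
      · rw [hxi b hbt] at hb
        exact h.stable b hb hbD
    refine this.imp ?_ ?_
    · rintro ⟨h1, d, hd1, hd2, hd3⟩
      exact ⟨h1, d, hd1, hmono hd2, hd3⟩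
    · rintro ⟨h1, h2⟩
      exact ⟨h1, fun d hd => ⟨hmono (h2 d hd).1, (h2 d hd).2⟩⟩
  · obtain ⟨d, hd1, hd2, hd3⟩ := h.parB b hb
    exact ⟨d, hd1, hmono hd2, hd3.congr (hxi d (hne hd2)) (hxi b (ne_of_mem_of_not_mem hb htB))⟩

/-- The closure process again, now without targets or virtual arcs, to provide the reduced set that
`exists_loose` requires. -/
theorem exists_reduced (hs : ∀ i, (N.inputs i).Nonempty) :
    ∀ (n : ℕ) {R : Finset V} (x : V → Bool), R.card = n →
    ∃ R' ⊆ R, ∃ w : List V, (∀ i ∈ w, i ∈ R) ∧ w.length + R'.card ≤ R.card ∧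
      N.Reduced R' (N.map.act w x) ∧
      ∀ b ∈ R, b ∉ R' → ∃ j ∈ N.inputs b, j ∉ R' ∧ N.Cons (N.map.act w x) j b := by
  intro n
  induction n with
  | zero =>
    intro R x hR
    rw [Finset.card_eq_zero] at hR
    subst hR
    exact ⟨∅, subset_rfl, [], by simp, by simp, fun e he => by simp at he, by simp⟩
  | succ n ih =>
    intro R x hR
    by_cases hred : N.Reduced R x
    · exact ⟨R, subset_rfl, [], by simp, by simp, hred, fun b hb hb' => absurd hb hb'⟩
    obtain ⟨e, he, j, hj, hjR, hcons⟩ := exists_forced hs hred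
    have hcard := Finset.card_erase_add_one he
    obtain ⟨R', hR', w, hw, hlen, hred', hpar⟩ :=
      ih (R := R.erase e) (N.map.step e x) (by omega)
    refine ⟨R', hR'.trans (Finset.erase_subset _ _), e :: w, fun i hi => ?_, ?_, hred', ?_⟩
    · rcases List.mem_cons.1 hi with rfl | hi
      exacts [he, Finset.mem_of_mem_erase (hw i hi)]
    · simp only [List.length_cons]
      omega
    · intro b hb hbR'
      by_cases hbe : b = e
      · subst hbe
        have hact : ∀ k ∉ R.erase b, N.map.act w (N.map.step b x) k = N.map.step b x k :=
          fun k hk => BooleanNetwork.act_of_notMem _ (fun h => hk (hw k h)) _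
        have hjR' : j ∉ R.erase b := fun h => hjR (Finset.mem_of_mem_erase h)
        exact ⟨j, hj, fun h => hjR' (hR' h),
          hcons.congr (hact j hjR') (hact b (Finset.notMem_erase _ _))⟩
      · exact hpar b (Finset.mem_erase.2 ⟨hbe, hb⟩) hbR'

end

variable [Fintype V]

theorem Spread.congr {D₀ B : Finset V} {x y x' y' : V → Bool} (h : N.Spread D₀ B x y)
    (hd : diff x' y' = diff x y) (hx : ∀ i, x i ≠ y i → x' i = x i)
    (hy : ∀ i, x i ≠ y i → y' i = y i) (hB : ∀ i ∈ B, x' i = x i) : N.Spread D₀ B x' y' := by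
  have hiff : ∀ {i}, x' i ≠ y' i ↔ x i ≠ y i := by
    intro i
    rw [← mem_diff, ← mem_diff, hd]
  refine ⟨fun b hb => hiff.2 (h.subset b hb), fun b hb => ?_, fun b hb hbD => ?_,
    fun b hb hbD => ?_, fun b hb => ?_⟩
  · exact not_not.1 fun hn => hiff.1 hn (h.disj b hb)
  · obtain ⟨d, hd1, hd2, hd3⟩ := h.par b (hiff.1 hb) hbD
    exact ⟨d, hd1, hiff.2 hd2, hd3.congr (hx d hd2) (hx b (hiff.1 hb))⟩
  · rw [hy b (hiff.1 hb)]
    refine (h.stable b (hiff.1 hb) hbD).imp ?_ ?_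
    · rintro ⟨h1, d, hd1, hd2, hd3⟩
      exact ⟨h1, d, hd1, hiff.2 hd2, by rwa [hy d hd2]⟩
    · rintro ⟨h1, h2⟩
      exact ⟨h1, fun d hd => ⟨hiff.2 (h2 d hd).1, by rw [hy d (h2 d hd).1, (h2 d hd).2]⟩⟩
  · obtain ⟨d, hd1, hd2, hd3⟩ := h.parB b hb
    exact ⟨d, hd1, hiff.2 hd2, hd3.congr (hx d hd2) (hB b hb)⟩

variable [DecidableEq V]

theorem diff_act_eq : ∀ {w : List V} {x y : V → Bool},
    (∀ t ∈ w, x t = y t ∧ ∀ j ∈ N.inputs t, x j = y j) →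
    diff (N.map.act w x) (N.map.act w y) = diff x y
  | [], _, _, _ => rfl
  | t :: w, x, y, h => by
    obtain ⟨h1, h2⟩ := h t List.mem_cons_self
    have hd : diff (N.map.step t x) (N.map.step t y) = diff x y := by
      rw [diff_step_erase (map_congr h2), Finset.erase_eq_of_notMem (notMem_diff.2 h1)]
    have hiff : ∀ {i}, x i = y i ↔ N.map.step t x i = N.map.step t y i := by
      intro i
      rw [← notMem_diff, ← notMem_diff, hd]
    rw [BooleanNetwork.act_cons, BooleanNetwork.act_cons, diff_act_eq, hd]
    intro u hu
    obtain ⟨h3, h4⟩ := h u (List.mem_cons_of_mem _ hu)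
    exact ⟨hiff.1 h3, fun j hj => hiff.1 (h4 j hj)⟩

/-- Setting a vertex `t`, which could be infected, to the same value in both configurations. -/
theorem Spread.block {D₀ B : Finset V} {x y : V → Bool} (h : N.Spread D₀ B x y) {t : V}
    (ht : x t = y t) (hxy : N.map x t = N.map y t) (hx : N.map x t = !x t)
    (hp : ∃ d ∈ N.inputs t, x d ≠ y d ∧ ¬ N.Cons x d t) :
    N.Spread D₀ (insert t B) (N.map.step t x) (N.map.step t y) := by
  have hne : ∀ {i}, x i ≠ y i → i ≠ t := fun hi hit => hi (hit ▸ ht)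
  have hd : diff (N.map.step t x) (N.map.step t y) = diff x y := by
    rw [diff_step_erase hxy, Finset.erase_eq_of_notMem (notMem_diff.2 ht)]
  have hmono : ∀ {i}, x i ≠ y i → N.map.step t x i ≠ N.map.step t y i := fun hi => by
    rwa [← mem_diff, hd, mem_diff]
  have hB : N.Spread D₀ (B.erase t) (N.map.step t x) (N.map.step t y) := by
    refine Spread.congr (x := x) (y := y)
      ⟨h.subset, fun b hb => h.disj b (Finset.mem_of_mem_erase hb), h.par, h.stable,
        fun b hb => h.parB b (Finset.mem_of_mem_erase hb)⟩ hd
      (fun i hi => BooleanNetwork.step_of_ne _ (hne hi) x)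
      (fun i hi => BooleanNetwork.step_of_ne _ (hne hi) y)
      (fun i hi => BooleanNetwork.step_of_ne _ (Finset.ne_of_mem_erase hi) x)
  have hmem : ∀ {b}, b ∈ insert t B → b = t ∨ b ∈ B.erase t := fun {b} hb => by
    by_cases hbt : b = t
    · exact Or.inl hbt
    · exact Or.inr (Finset.mem_erase.2 ⟨hbt, (Finset.mem_insert.1 hb).resolve_left hbt⟩)
  refine ⟨hB.subset, fun b hb => ?_, hB.par, hB.stable, fun b hb => ?_⟩
  · rcases hmem hb with rfl | hb
    · rw [BooleanNetwork.step_self, BooleanNetwork.step_self, hxy]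
    · exact hB.disj b hb
  · rcases hmem hb with rfl | hb
    · obtain ⟨d, hd1, hd2, hd3⟩ := hp
      exact ⟨d, hd1, hmono hd2, Cons.of_flip hd3 (BooleanNetwork.step_of_ne _ (hne hd2) x)
        (by rw [BooleanNetwork.step_self, hx])⟩
    · exact hB.parB b hb

/-- Outcome of the infection phase: without infecting any vertex, an input outside `D₀` of a vertex
of `D₀` loses its neutral value. -/
def Breached (N : CanalizingNet V) (D₀ : Finset V) (π : V → V) (k : ℕ) (x₀ y : V → Bool) : Prop :=
  ∃ w : List V, w.length ≤ phaseCost k ∧ diff (N.map.act w x₀) (N.map.act w y) = D₀ ∧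
    ¬ N.Rigid D₀ π (N.map.act w y)

/-- Outcome of the infection phase: the infection reaches an input of a vertex `v` of `U` all of whose
inputs have been made inconsistent. -/
def Invaded (N : CanalizingNet V) (D₀ U : Finset V) (π : V → V) (k : ℕ) (x y : V → Bool) : Prop :=
  ∃ w : List V, w.length ≤ phaseCost k ∧ N.Primed D₀ U π (N.map.act w x) ∧
    (∃ B, N.Spread D₀ B (N.map.act w x) (N.map.act w y)) ∧ N.Rigid D₀ π (N.map.act w y) ∧
    ∃ v ∈ U, ∃ u ∈ N.inputs v, u ∉ D₀ ∧ N.map.act w x u ≠ N.lit u v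

/-- Only clean vertices, those neither infected nor blocked and with no infected input, are updated,
so x and y evolve alike. Infected and blocked vertices have consistent infected inputs, except for
the primed roots. The vertex that becomes loose is therefore a root or a vertex at the frontier of
the infection; in the latter case it counts among the k vertices without being clean, which improves
the bound to k - 1. -/
theorem Spread.exists_loose (hs : ∀ i, (N.inputs i).Nonempty) (hv : N.VirtuallyAccessible)
    (hc : N.NoConsistentCycle) {D₀ U B : Finset V} {π : V → V} {x y z : V → Bool}
    (hz : N.Rigid D₀ π z) (hne : D₀.Nonempty) (h : N.Spread D₀ B x y)
    (hp : N.Primed D₀ U π x) {k : ℕ} (hk : (Finset.univ \ (diff x y ∪ B)).card = k) :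
    ∃ w : List V, (∀ i ∈ w, x i = y i ∧ i ∉ B ∧ ∀ j ∈ N.inputs i, x j = y j) ∧
      ∃ t, (∀ j ∈ N.inputs t, ¬ N.Cons (N.map.act w x) j t) ∧
        ((t ∈ U ∧ w.length + 2 ≤ 2 * fib (k + 2)) ∨
          (x t = y t ∧ t ∉ B ∧ (∃ d ∈ N.inputs t, x d ≠ y d) ∧
            ∃ k', k = k' + 1 ∧ w.length + 2 ≤ 2 * fib (k' + 2))) := by
  classical
  set R := Finset.univ.filter fun t => x t = y t ∧ t ∉ B ∧ ∀ j ∈ N.inputs t, x j = y j with hR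
  have hmem : ∀ {t}, t ∈ R ↔ x t = y t ∧ t ∉ B ∧ ∀ j ∈ N.inputs t, x j = y j := by
    intro t
    simp [hR]
  obtain ⟨R', hR', w₁, hw₁, hlen₁, hred, hpar⟩ := exists_reduced hs _ x (rfl : R.card = _)
  have hact : ∀ i ∉ R, N.map.act w₁ x i = x i := fun i hi =>
    BooleanNetwork.act_of_notMem _ (fun h => hi (hw₁ i h)) x
  have hdR : ∀ {i}, x i ≠ y i → i ∉ R := fun hi hiR => hi (hmem.1 hiR).1
  obtain ⟨v, hvD⟩ := hne
  obtain ⟨w₂, hw₂, hlen₂, t, ht, hfree⟩ := CanalizingNet.exists_loose hs hv hc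
    (R := R') (T := Finset.univ.filter fun t => t ∉ R' ∧
      ¬ ∃ j ∈ N.inputs t, j ∉ R' ∧ N.Cons (N.map.act w₁ x) j t)
    ⟨v, fun h' => hdR (h.subset v hvD) (hR' h')⟩ hred (fun t ht => (Finset.mem_filter.1 ht).2.1)
    (fun b hb hbT => by
      by_contra hn
      exact hbT (Finset.mem_filter.2 ⟨Finset.mem_univ b, hb, hn⟩))
  obtain ⟨-, htR', htp⟩ := Finset.mem_filter.1 ht
  refine ⟨w₁ ++ w₂, fun i hi => hmem.1 ((List.mem_append.1 hi).elim (hw₁ i) fun h => hR' (hw₂ i h)),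
    t, by rwa [BooleanNetwork.act_append], ?_⟩
  rw [List.length_append]
  have hpar' : ∀ d ∈ N.inputs t, x d ≠ y d → t ∉ R → ¬ N.Cons x d t := fun d hd hne htR hcons =>
    htp ⟨d, hd, fun h => hdR hne (hR' h), hcons.congr (hact d (hdR hne)) (hact t htR)⟩
  have hRsub : R ⊆ Finset.univ \ (diff x y ∪ B) := fun i hi => by
    obtain ⟨h1, h2, -⟩ := hmem.1 hi
    simp [mem_diff, h1, h2]
  by_cases htd : x t = y t
  · right
    have htB : t ∉ B := fun htB => by
      obtain ⟨d, hd1, hd2, hd3⟩ := h.parB t htB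
      exact hpar' d hd1 hd2 (fun h => (hmem.1 h).2.1 htB) hd3
    have htR : t ∉ R := fun htR => htp (hpar t htR htR')
    have htin : ∃ d ∈ N.inputs t, x d ≠ y d := by
      by_contra! hcon
      exact htR (hmem.2 ⟨htd, htB, hcon⟩)
    have hlt : R.card < k := by
      rw [← hk]
      refine Finset.card_lt_card ((Finset.ssubset_iff_of_subset hRsub).2 ⟨t, ?_, htR⟩)
      simp [mem_diff, htd, htB]
    refine ⟨htd, htB, htin, k - 1, by omega, ?_⟩
    have := add_two_mul_fib_le (f := w₁.length) (h := R'.card) (k := k - 1) (by omega)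
    omega
  · left
    have htR := hdR htd
    refine ⟨?_, ?_⟩
    · by_contra htU
      by_cases htD : t ∈ D₀
      · obtain ⟨h1, h2, -⟩ := hz t htD
        exact hpar' _ h2 (h.subset _ h1) htR (hp.cons t htD htU)
      · obtain ⟨d, hd1, hd2, hd3⟩ := h.par t htd htD
        exact hpar' d hd1 hd2 htR hd3
    · have h1 := Finset.card_le_card hRsub
      have := add_two_mul_fib_le (f := w₁.length) (h := R'.card) (k := k) (by omega)
      omega

/-- A loose frontier vertex t flips in x. If y gives it the same image, t is updated in both and
blocked; otherwise t is stable in y and becomes infected. Either way the number of vertices still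
open drops. The process ends when a root is loose. The configuration x₀, equal to x on D₀ and to y
elsewhere, follows the same run without infections, so its difference from y remains D₀. -/
theorem Spread.breached_or_invaded (hs : ∀ i, (N.inputs i).Nonempty) (hv : N.VirtuallyAccessible)
    (hc : N.NoConsistentCycle) {D₀ U : Finset V} {π : V → V} {z : V → Bool}
    (hz : N.Rigid D₀ π z) (hne : D₀.Nonempty) (hU : N.EntrySet D₀ U π) :
    ∀ (k : ℕ) {B : Finset V} {x y x₀ : V → Bool}, (Finset.univ \ (diff x y ∪ B)).card = k →
      N.Spread D₀ B x y → N.Primed D₀ U π x → (∀ i ∈ D₀, x₀ i = x i) → (∀ i ∉ D₀, x₀ i = y i) →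
      N.Breached D₀ π k x₀ y ∨ N.Invaded D₀ U π k x y := by
  intro k
  induction k using Nat.strong_induction_on with
  | _ k ih =>
  intro B x y x₀ hk h hp hx₀ hy₀
  obtain ⟨w, hw, t, hfree, hcase⟩ := h.exists_loose hs hv hc hz hne hp hk
  have hd₀ : diff x₀ y = D₀ := by
    ext i
    rw [mem_diff]
    by_cases hi : i ∈ D₀
    · simp [hi, hx₀ i hi, h.subset i hi]
    · simp [hi, hy₀ i hi]
  have hagree : ∀ {i}, x i = y i → x₀ i = y i := fun {i} hi =>
    hy₀ i fun hiD => h.subset i hiD hi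
  have hd₁ : diff (N.map.act w x) (N.map.act w y) = diff x y :=
    diff_act_eq fun i hi => ⟨(hw i hi).1, (hw i hi).2.2⟩
  have hd₂ : diff (N.map.act w x₀) (N.map.act w y) = D₀ := by
    rw [diff_act_eq, hd₀]
    exact fun i hi => ⟨hagree (hw i hi).1, fun j hj => hagree ((hw i hi).2.2 j hj)⟩
  have hfix : ∀ {v : V → Bool} {i}, x i ≠ y i → N.map.act w v i = v i := fun hi =>
    BooleanNetwork.act_of_notMem _ (fun hiw => hi (hw _ hiw).1) _
  set x₁ := N.map.act w x with hx₁def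
  set y₁ := N.map.act w y with hy₁def
  set x₂ := N.map.act w x₀ with hx₂def
  have h₁ : N.Spread D₀ B x₁ y₁ := h.congr hd₁ (fun i hi => hfix hi) (fun i hi => hfix hi)
    fun i hi => BooleanNetwork.act_of_notMem _ (fun hiw => (hw i hiw).2.1 hi) _
  have hp₁ : N.Primed D₀ U π x₁ := hp.congr hz hU.subset fun i hi => hfix (h.subset i hi)
  have hx₂ : ∀ i ∈ D₀, x₂ i = x₁ i := fun i hi => by
    rw [hx₂def, hx₁def, hfix (h.subset i hi), hfix (h.subset i hi), hx₀ i hi]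
  have hy₂ : ∀ i ∉ D₀, x₂ i = y₁ i := fun i hi => by
    rw [← notMem_diff, hd₂]
    exact hi
  rcases hcase with ⟨htU, hlen⟩ | ⟨ht, htB, ⟨d, hd, hdne⟩, k', rfl, hlen⟩
  · have hlen' : w.length ≤ phaseCost k := by
      have := le_phaseCost k
      omega
    obtain ⟨j, hj, hjD⟩ := hU.entry t htU
    by_cases hrig : N.Rigid D₀ π y₁
    -- The root t is loose and has its top value, so none of its inputs has its literal value in x;
    -- this includes its entry j outside D₀.
    · refine Or.inr ⟨w, hlen', hp₁, ⟨B, h₁⟩, hrig, t, htU, j, hj, hjD, fun hl => hfree j hj ?_⟩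
      exact iff_of_true hl (hp₁.root t htU)
    · exact Or.inl ⟨w, hlen', hd₂, hrig⟩
  have ht₁ : x₁ t = y₁ t := by rwa [← notMem_diff, hd₁, notMem_diff]
  have hd₁ne : x₁ d ≠ y₁ d := by rwa [← mem_diff, hd₁, mem_diff]
  have hmapx : N.map x₁ t = !x₁ t := map_eq_not_of_loose (hs t) hfree
  have htD : t ∉ D₀ := fun htD => h.subset t htD ht
  have hmem : t ∈ Finset.univ \ (diff x y ∪ B) := by simp [mem_diff, ht, htB]
  have hcost := phaseCost_succ k'
  by_cases hxy : N.map x₁ t = N.map y₁ t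
  · have hy₁t : N.map y₁ t ≠ N.top t := fun hy => by
      have h1 := eq_lit_of_map_eq_top hy hd
      have h2 := eq_lit_of_map_eq_top (hxy.trans hy) hd
      exact hd₁ne (h2.trans h1.symm)
    have hx₁t : x₁ t = N.top t := by
      rw [← hxy, hmapx] at hy₁t
      cases hx : x₁ t <;> cases ht : N.top t <;> simp_all
    -- The input j is not at its literal value in either x₁ or y₁, so these agree at j, which thus
    -- lies outside D₀. There x₂ equals y₁, and hence x₂ gives t the same image.
    obtain ⟨j, hj, hjl⟩ : ∃ j ∈ N.inputs t, y₁ j ≠ N.lit j t := by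
      by_contra! hcon
      exact hy₁t (map_eq_top hcon)
    have hjx : x₁ j ≠ N.lit j t := fun hl => hfree j hj (iff_of_true hl hx₁t)
    have hjD : j ∉ D₀ := fun hjD => h₁.subset j hjD (by
      cases hx : x₁ j <;> cases hy : y₁ j <;> cases hl : N.lit j t <;> simp_all)
    have hx₂t : N.map x₂ t = N.map y₁ t := by
      rw [map_eq_not_top hj hjl, map_eq_not_top hj (by rwa [hy₂ j hjD])]
    have hd₃ : diff (N.map.step t x₁) (N.map.step t y₁) = diff x y := by
      rw [diff_step_erase hxy, hd₁, Finset.erase_eq_of_notMem (notMem_diff.2 ht)]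
    have hcard : (Finset.univ \ (diff (N.map.step t x₁) (N.map.step t y₁) ∪ insert t B)).card =
        k' := by
      rw [hd₃, Finset.union_insert, Finset.sdiff_insert, Finset.card_erase_of_mem hmem, hk]
      rfl
    have hne' : ∀ {v : V → Bool} {i}, i ∈ D₀ → N.map.step t v i = v i := fun hi =>
      BooleanNetwork.step_of_ne _ (ne_of_mem_of_not_mem hi htD) _
    have hres := ih k' (by omega) (x₀ := N.map.step t x₂) hcard
      (h₁.block ht₁ hxy hmapx ⟨d, hd, hd₁ne, hfree d hd⟩)
      (hp₁.congr hz hU.subset fun i hi => hne' hi)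
      (fun i hi => by rw [hne' hi, hne' hi, hx₂ i hi])
      (fun i hi => by
        by_cases hit : i = t
        · subst hit
          rw [BooleanNetwork.step_self, BooleanNetwork.step_self, hx₂t]
        · rw [BooleanNetwork.step_of_ne _ hit, BooleanNetwork.step_of_ne _ hit, hy₂ i hi])
    have hact : ∀ (w' : List V) (v : V → Bool), N.map.act (w ++ t :: w') v =
        N.map.act w' (N.map.step t (N.map.act w v)) := fun w' v => by
      rw [BooleanNetwork.act_append, BooleanNetwork.act_cons]
    refine hres.imp ?_ ?_
    · rintro ⟨w', hw', hres⟩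
      refine ⟨w ++ t :: w', ?_, by simpa only [hact] using hres⟩
      simp only [List.length_append, List.length_cons]
      omega
    · rintro ⟨w', hw', hres⟩
      refine ⟨w ++ t :: w', ?_, by simpa only [hact] using hres⟩
      simp only [List.length_append, List.length_cons]
      omega
  · have hyt : N.map y₁ t = y₁ t := by
      rw [hmapx, ht₁] at hxy
      cases hy : y₁ t <;> cases hm : N.map y₁ t <;> simp_all
    have hst : (y₁ t = !N.top t ∧ ∃ d ∈ N.inputs t, x₁ d ≠ y₁ d ∧ y₁ d ≠ N.lit d t) ∨
        (y₁ t = N.top t ∧ ∀ d ∈ N.inputs t, x₁ d ≠ y₁ d ∧ y₁ d = N.lit d t) := by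
      by_cases htop : y₁ t = N.top t
      · refine Or.inr ⟨htop, fun j hj => ?_⟩
        have hjy := eq_lit_of_map_eq_top (hyt.trans htop) hj
        refine ⟨fun hxy => hfree j hj ?_, hjy⟩
        exact iff_of_true (hxy.trans hjy) (ht₁.trans htop)
      · refine Or.inl ⟨ne_top_iff.1 htop, d, hd, hd₁ne, fun hl => hfree d hd ?_⟩
        exact iff_of_false (fun hl' => hd₁ne (hl'.trans hl.symm)) (by rwa [ht₁])
    have hd₃ : diff (N.map.step t x₁) y₁ = insert t (diff x y) := by
      conv_lhs => rw [← BooleanNetwork.step_eq_self _ hyt]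
      rw [diff_step_of_ne hxy, hd₁]
    have hcard : (Finset.univ \ (diff (N.map.step t x₁) y₁ ∪ B)).card = k' := by
      rw [hd₃, Finset.insert_union, Finset.sdiff_insert, Finset.card_erase_of_mem hmem, hk]
      rfl
    have hne' : ∀ {v : V → Bool} {i}, i ∈ D₀ → N.map.step t v i = v i := fun hi =>
      BooleanNetwork.step_of_ne _ (ne_of_mem_of_not_mem hi htD) _
    -- The update of t infects x and leaves y fixed, so the run of (x₀, y) can omit it.
    have hres := ih k' (by omega) (x₀ := x₂) hcard
      (h₁.infect htB ht₁ hyt hmapx ⟨d, hd, hd₁ne, hfree d hd⟩ hst)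
      (hp₁.congr hz hU.subset fun i hi => hne' hi)
      (fun i hi => by rw [hne' hi, hx₂ i hi]) hy₂
    refine hres.imp ?_ ?_
    · rintro ⟨w', hw', hres⟩
      refine ⟨w ++ w', ?_, by simpa only [BooleanNetwork.act_append] using hres⟩
      simp only [List.length_append]
      omega
    · rintro ⟨w', hw', hres⟩
      have hact : N.map.act (w ++ t :: w') x = N.map.act w' (N.map.step t x₁) := by
        rw [BooleanNetwork.act_append, BooleanNetwork.act_cons]
      have hact' : N.map.act (w ++ t :: w') y = N.map.act w' y₁ := by
        rw [BooleanNetwork.act_append, BooleanNetwork.act_cons, ← hy₁def,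
          BooleanNetwork.step_eq_self _ hyt]
      refine ⟨w ++ t :: w', ?_, by rw [hact, hact']; exact hres⟩
      simp only [List.length_append, List.length_cons]
      omega

end CanalizingNet

/-! ### Cutting a cycle and merging two configurations. -/

namespace CanalizingNet

open Nat (fib)

variable {V : Type*} {N : CanalizingNet V}

variable [DecidableEq V]

/-- The configuration obtained by switching the components of `W`. -/
def flipOn (W : Finset V) (x : V → Bool) : V → Bool := fun i => if i ∈ W then !x i else x i

theorem flipOn_flipOn (W : Finset V) (x : V → Bool) : flipOn W (flipOn W x) = x := by
  funext i
  by_cases hi : i ∈ W <;> simp [flipOn, hi]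

theorem cons_flipOn {W : Finset V} {x : V → Bool} {j i : V} (hj : j ∈ W) (hi : i ∈ W) :
    N.Cons (flipOn W x) j i ↔ N.Cons x j i :=
  cons_compl (by simp [flipOn, hj]) (by simp [flipOn, hi])

/-- Updating `v` and then the vertices that depend on it switches all of them. -/
theorem Rigid.act_eq_flipOn {D W : Finset V} {π : V → V} {y : V → Bool} (h : N.Rigid D π y)
    (hW : W ⊆ D) (hπ : ∀ b ∈ W, π b ∈ W) {v : V} (hv : v ∈ W) (hA : N.Acyc (W.erase v))
    (hcons : ∀ b ∈ W, b ≠ v → N.Cons y (π b) b) (hn : ¬ N.Cons y (π v) v) {l : List V}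
    (hl : ∀ i ∈ l, i ∈ W.erase v)
    (hst : ∀ x, ∀ b ∈ W.erase v, N.map (N.map.act l x) b = N.map.act l x b) :
    N.map.act (v :: l) y = flipOn W y := by
  have hR : N.Rigid D π (flipOn W y) := h.congr fun k hk => by
    have : k ∉ W := fun h => hk (hW h)
    simp [flipOn, this]
  refine hA.eq_of_stable (hst _) (fun b hb => ?_) fun b hb => ?_
  · obtain ⟨hbv, hbW⟩ := Finset.mem_erase.1 hb
    rw [hR.map_eq_iff (hW hbW), cons_flipOn (hπ b hbW) hbW]
    exact hcons b hbW hbv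
  · rw [BooleanNetwork.act_cons, BooleanNetwork.act_of_notMem _ fun h => hb (hl b h)]
    by_cases hbv : b = v
    · subst hbv
      rw [BooleanNetwork.step_self]
      have := (h.map_eq_iff (hW hv)).not.2 hn
      simp only [flipOn, hv, if_true]
      cases h1 : N.map y b <;> cases h2 : y b <;> simp_all
    · have : b ∉ W := fun h => hb (Finset.mem_erase.2 ⟨hbv, h⟩)
      simp [flipOn, this, BooleanNetwork.step_of_ne _ hbv]

/-- On D₀ the arcs consistent in x are consistent in y as well, both ends being switched; outside D₀
infected vertices are stable in y by `Spread.stable`. -/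
theorem Spread.map_eq {D₀ U B : Finset V} {π : V → V} {x y : V → Bool} (h : N.Spread D₀ B x y)
    (hp : N.Primed D₀ U π x) (hR : N.Rigid D₀ π y) {b : V} (hb : x b ≠ y b) (hbU : b ∉ U) :
    N.map y b = y b := by
  by_cases hbD : b ∈ D₀
  · rw [hR.map_eq_iff hbD]
    have h1 := h.subset _ (hR b hbD).1
    have h2 := hp.cons b hbD hbU
    exact (cons_compl h1 hb).2 h2
  · rcases h.stable b hb hbD with ⟨h1, d, hd, -, hdl⟩ | ⟨h1, h2⟩
    · rw [h1, map_eq_not_top hd hdl]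
    · rw [h1, map_eq_top fun d hd => (h2 d hd).2]

variable [Fintype V]

/-- If `y` is stable on the vertices outside `U` on which `x` and `y` differ, then `x` can be brought
closer to `y` until these vertices have different images. -/
theorem exists_act_alternating {U : Finset V} {y : V → Bool} :
    ∀ (n : ℕ) {x : V → Bool}, (diff x y).card = n → (∀ b, x b ≠ y b → b ∉ U → N.map y b = y b) →
    ∃ w : List V, N.map.act w y = y ∧ diff (N.map.act w x) y ⊆ diff x y ∧
      w.length + (diff (N.map.act w x) y).card ≤ (diff x y).card ∧
      ∀ b, N.map.act w x b ≠ y b → b ∉ U → N.map (N.map.act w x) b ≠ N.map y b := by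
  intro n
  induction n using Nat.strong_induction_on with
  | _ n ih =>
  intro x hn hy
  by_cases halt : ∀ b, x b ≠ y b → b ∉ U → N.map x b ≠ N.map y b
  · exact ⟨[], rfl, subset_rfl, by simp [BooleanNetwork.act_nil], halt⟩
  push Not at halt
  obtain ⟨b, hb, hbU, he⟩ := halt
  have hstep : N.map.step b y = y := BooleanNetwork.step_eq_self _ (hy b hb hbU)
  have hss := diff_step_ssubset (mem_diff.2 hb) he
  rw [hstep] at hss
  have hlt := Finset.card_lt_card hss
  obtain ⟨w, h1, h2, h3, h4⟩ := ih _ (hn ▸ hlt) rfl fun c hc hcU =>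
    hy c (mem_diff.1 (hss.subset (mem_diff.2 hc))) hcU
  refine ⟨b :: w, by rw [BooleanNetwork.act_cons, hstep, h1], h2.trans hss.subset, ?_, h4⟩
  rw [List.length_cons, BooleanNetwork.act_cons]
  omega

/-- Let W be a π-closed set meeting U only in v. Updating v and restabilizing W switches all of W in
y, so doing this twice restores y. In x, the invaded input u forces v to the opposite of its top
value, which is its value in y, so v leaves the difference. Moving x towards y next ensures that
arcs inside the remaining difference and outside U are consistent in y, and these contain no cycle.
-/
theorem Invaded.exists_cut (hc : N.NoConsistentCycle) {s : ℕ}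
    (hs : ∀ S, N.Acyc S → S.card ≤ s) {D₀ U : Finset V} {π : V → V} {k : ℕ} {x y : V → Bool}
    (hU : N.EntrySet D₀ U π) (h : N.Invaded D₀ U π k x y) :
    ∃ w : List V, ∃ c, w.length ≤ phaseCost k + 2 * (s + 1) + c ∧
      c + (diff (N.map.act w x) (N.map.act w y)).card + 1 ≤ Fintype.card V ∧
      ∃ v ∈ U, N.Acyc (diff (N.map.act w x) (N.map.act w y) \ U.erase v) := by
  obtain ⟨w, hw, hp, ⟨B, hS⟩, hR, v, hvU, u, hu, huD, hul⟩ := h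
  set x₁ := N.map.act w x
  set y₁ := N.map.act w y
  obtain ⟨W, hWD, hvW, hπ, huniq⟩ := hU.cycle v hvU
  have hA : N.Acyc (W.erase v) := hU.acyc.mono fun i hi => by
    obtain ⟨h1, h2⟩ := Finset.mem_erase.1 hi
    exact Finset.mem_sdiff.2 ⟨hWD h2, fun h => h1 (huniq i h2 h)⟩
  obtain ⟨l, hl, hlen, hst⟩ := hA.exists_stabilizing _ rfl
  have hlW : ∀ i ∈ v :: l, i ∈ W := fun i hi => by
    rcases List.mem_cons.1 hi with rfl | hi
    exacts [hvW, Finset.mem_of_mem_erase (hl i hi)]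
  have hvl : v ∉ l := fun h => Finset.notMem_erase _ _ (hl v h)
  have hcons : ∀ b ∈ W, b ≠ v → N.Cons y₁ (π b) b := fun b hb hbv => by
    have hbU : b ∉ U := fun h => hbv (huniq b hb h)
    exact (hR.map_eq_iff (hWD hb)).1 (hS.map_eq hp hR (hS.subset b (hWD hb)) hbU)
  have hvD := hWD hvW
  have hn : ¬ N.Cons y₁ (π v) v := by
    have h1 := hS.subset _ (hR v hvD).1
    have h2 := hS.subset v hvD
    have h3 := hp.not_cons v hvU
    rwa [cons_compl h1 h2]
  have hflip : N.map.act (v :: l) y₁ = flipOn W y₁ :=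
    hR.act_eq_flipOn hWD hπ hvW hA hcons hn hl hst
  have hflip' : N.map.act (v :: l) (flipOn W y₁) = y₁ := by
    have hR' : N.Rigid D₀ π (flipOn W y₁) := hR.congr fun k hk => by
      have : k ∉ W := fun h => hk (hWD h)
      simp [flipOn, this]
    rw [hR'.act_eq_flipOn hWD hπ hvW hA
      (fun b hb hbv => (cons_flipOn (hπ b hb) hb).2 (hcons b hb hbv))
      ((cons_flipOn (hπ v hvW) hvW).not.2 hn) hl hst, flipOn_flipOn]
  set x₂ := N.map.act (v :: l) (N.map.act (v :: l) x₁) with hx₂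
  have hx₂v : x₂ v = y₁ v := by
    have huW : u ∉ v :: l := fun h => huD (hWD (hlW u h))
    rw [hx₂, BooleanNetwork.act_cons, BooleanNetwork.act_of_notMem _ hvl, BooleanNetwork.step_self,
      map_eq_not_top hu (by rwa [BooleanNetwork.act_of_notMem _ huW]), ← hp.root v hvU]
    have := hS.subset v hvD
    cases hx : x₁ v <;> cases hy : y₁ v <;> simp_all
  have hx₂i : ∀ i ∉ W, x₂ i = x₁ i := fun i hi => by
    rw [hx₂, BooleanNetwork.act_of_notMem _ fun h => hi (hlW i h),
      BooleanNetwork.act_of_notMem _ fun h => hi (hlW i h)]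
  have hsub : ∀ {i}, x₂ i ≠ y₁ i → x₁ i ≠ y₁ i := fun {i} hi => by
    by_cases hiW : i ∈ W
    · exact hS.subset i (hWD hiW)
    · rwa [hx₂i i hiW] at hi
  obtain ⟨w', hw'y, hw'sub, hw'len, halt⟩ := exists_act_alternating (U := U) _ (x := x₂) (y := y₁)
    rfl fun b hb hbU => hS.map_eq hp hR (hsub hb) hbU
  have hacty : N.map.act (w ++ ((v :: l) ++ (v :: l)) ++ w') y = y₁ := by
    rw [BooleanNetwork.act_append, BooleanNetwork.act_append, BooleanNetwork.act_append, hflip,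
      hflip', hw'y]
  have hactx : N.map.act (w ++ ((v :: l) ++ (v :: l)) ++ w') x = N.map.act w' x₂ := by
    rw [BooleanNetwork.act_append, BooleanNetwork.act_append, BooleanNetwork.act_append]
  refine ⟨w ++ ((v :: l) ++ (v :: l)) ++ w', w'.length, ?_, ?_, v, hvU, ?_⟩
  · have := hs _ hA
    simp only [List.length_append, List.length_cons]
    omega
  · rw [hacty, hactx]
    have : (diff x₂ y₁).card < Fintype.card V := by
      rw [← Finset.card_univ]
      exact Finset.card_lt_card ((Finset.ssubset_iff_of_subset (Finset.subset_univ _)).2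
        ⟨v, Finset.mem_univ v, notMem_diff.2 hx₂v⟩)
    omega
  · rw [hacty, hactx]
    intro W' hW' hne
    obtain ⟨b, hb, hb'⟩ := hc y₁ W' hne
    refine ⟨b, hb, fun j hj hjb => hb' j hj hjb ?_⟩
    have hmem : ∀ {i}, i ∈ W' → N.map.act w' x₂ i ≠ y₁ i ∧ i ∉ U := fun {i} hi => by
      obtain ⟨h1, h2⟩ := Finset.mem_sdiff.1 (hW' hi)
      refine ⟨mem_diff.1 h1, fun h => h2 (Finset.mem_erase.2 ⟨?_, h⟩)⟩
      rintro rfl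
      exact mem_diff.1 (hw'sub h1) hx₂v
    -- The images at b differ and b is stable in y, so the arc from j to b is consistent in y.
    have h1 := halt b (hmem hb).1 (hmem hb).2
    refine (map_eq_iff_cons h1.symm hjb (hmem hj).1.symm).1 ?_
    exact hS.map_eq hp hR (hsub (mem_diff.1 (hw'sub (mem_diff.2 (hmem hb).1)))) (hmem hb).2

/-- An outside input without its neutral value decides the image of b alike in both configurations,
so updating b removes it from the difference. -/
theorem Breached.exists_ssubset {D₀ : Finset V} {π : V → V} {z : V → Bool} (hz : N.Rigid D₀ π z)
    {k : ℕ} {x y : V → Bool} (h : N.Breached D₀ π k x y) :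
    ∃ w : List V, w.length ≤ phaseCost k + 1 ∧ diff (N.map.act w x) (N.map.act w y) ⊂ D₀ := by
  obtain ⟨w, hw, hd, hn⟩ := h
  obtain ⟨b, hb, j, hj, hjD, hjl⟩ : ∃ b ∈ D₀, ∃ j ∈ N.inputs b, j ∉ D₀ ∧
      N.map.act w y j ≠ N.lit j b := by
    by_contra! hcon
    exact hn fun b hb => ⟨(hz b hb).1, (hz b hb).2.1, (hz b hb).2.2.1, hcon b hb⟩
  refine ⟨w ++ [b], by simpa using hw, ?_⟩
  rw [BooleanNetwork.act_append, BooleanNetwork.act_append]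
  conv_rhs => rw [← hd]
  refine diff_step_ssubset (hd.symm ▸ hb) ?_
  have : N.map.act w x j = N.map.act w y j := by rwa [← notMem_diff, hd]
  rw [map_eq_not_top hj hjl, map_eq_not_top hj (by rwa [this])]

/-- The number of steps of one infection phase, including its preparation. -/
def levelCost (s n m : ℕ) : ℕ := 2 * s + m + phaseCost (n - m)

/-- The number of steps needed to cut a cycle, including those that bring the two configurations
away from each other. -/
def cutCost (s n m : ℕ) : ℕ := 2 * (s + 1) + (n - 1 - m) * (s + 2)

/-- The number of steps needed to merge two configurations that differ on `d` vertices, whose cycles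
are cut by `m` vertices. -/
def mergeCost (s n : ℕ) : ℕ → ℕ → ℕ
  | 0, d => d * (s + 2)
  | m + 1, d => d * (s + 2) + min (d - m) (s + 1) * levelCost s n (m + 1) + cutCost s n (m + 1) +
      ∑ k ∈ Finset.range m, ((s + 1) * levelCost s n (k + 1) + cutCost s n (k + 1))

/-- Bounding the minimum by s + 1 makes the dependence on d linear; this is needed after a cut,
which may enlarge the difference. -/
theorem mergeCost_le (s n m d : ℕ) : mergeCost s n m d ≤ d * (s + 2) +
    ∑ k ∈ Finset.range m, ((s + 1) * levelCost s n (k + 1) + cutCost s n (k + 1)) := by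
  cases m with
  | zero => simp [mergeCost]
  | succ m =>
    rw [mergeCost, Finset.sum_range_succ]
    have := Nat.mul_le_mul_right (levelCost s n (m + 1)) (min_le_right (d - m) (s + 1))
    omega

theorem mergeCost_succ_left (s n m d : ℕ) : mergeCost s n m d ≤ mergeCost s n (m + 1) d := by
  refine (mergeCost_le s n m d).trans ?_
  rw [mergeCost]
  omega

theorem mergeCost_succ_right (s n m d : ℕ) :
    mergeCost s n m d + (s + 2) ≤ mergeCost s n m (d + 1) := by
  cases m with
  | zero => simp only [mergeCost]; rw [Nat.add_mul]; omega
  | succ m =>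
    simp only [mergeCost]
    have : min (d - m) (s + 1) ≤ min (d + 1 - m) (s + 1) := min_le_min (by omega) le_rfl
    have := Nat.mul_le_mul_right (levelCost s n (m + 1)) this
    rw [Nat.add_mul d]
    omega

/-- Lexicographic induction on the size m of a cutting set and the size d of the difference. A
shrink or a breach lowers d at constant m; an invasion lowers m, possibly at the price of a larger
d. -/
theorem exists_merge (hin : ∀ i, (N.inputs i).Nonempty) (hv : N.VirtuallyAccessible)
    (hc : N.NoConsistentCycle) (hni : N.NoInitialCycle) {s : ℕ}
    (hs : ∀ S, N.Acyc S → S.card ≤ s) :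
    ∀ (m d : ℕ) {x y : V → Bool} {U : Finset V}, (diff x y).card ≤ d → N.Acyc (diff x y \ U) →
      U.card ≤ m → ∃ w : List V, N.map.act w x = N.map.act w y ∧
        w.length ≤ mergeCost s (Fintype.card V) m d := by
  intro m
  induction m with
  | zero =>
    intro d
    induction d with
    | zero =>
      intro x y U hd _ _
      refine ⟨[], ?_, by simp⟩
      rw [Nat.le_zero, Finset.card_eq_zero] at hd
      funext i
      exact notMem_diff.1 (hd ▸ Finset.notMem_empty i)
    | succ d ih =>
      intro x y U hd hA hU
      have hcost := mergeCost_succ_right s (Fintype.card V) 0 d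
      rcases shrink_or_rigid hc hs x y with ⟨w, hw, hss⟩ | ⟨π, hR⟩
      · have := Finset.card_lt_card hss
        obtain ⟨w', hw', hlen⟩ := ih (x := N.map.act w x) (y := N.map.act w y) (by omega)
          (hA.mono (Finset.sdiff_subset_sdiff hss.subset subset_rfl)) hU
        refine ⟨w ++ w', by rw [BooleanNetwork.act_append, BooleanNetwork.act_append, hw'], ?_⟩
        rw [List.length_append]
        omega
      · have hU₀ : U = ∅ := Finset.card_eq_zero.1 (by omega)
        subst hU₀
        rw [Finset.sdiff_empty, hR.acyc_iff subset_rfl] at hA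
        have hemp := hA _ subset_rfl fun b hb => (hR b hb).1
        obtain ⟨w, hw, hlen⟩ := ih (x := x) (y := y) (U := ∅) (by simp [hemp])
          (by rw [hemp]; intro W hW hne; simp_all) (by simp)
        exact ⟨w, hw, by omega⟩
  | succ m ihm =>
    intro d
    induction d with
    | zero =>
      intro x y U hd _ _
      refine ⟨[], ?_, by simp⟩
      rw [Nat.le_zero, Finset.card_eq_zero] at hd
      funext i
      exact notMem_diff.1 (hd ▸ Finset.notMem_empty i)
    | succ d ih =>
      intro x y U hd hA hU
      set n := Fintype.card V with hn
      have hcost := mergeCost_succ_right s n (m + 1) d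
      rcases shrink_or_rigid hc hs x y with ⟨w, hw, hss⟩ | ⟨π, hR⟩
      · have := Finset.card_lt_card hss
        obtain ⟨w', hw', hlen⟩ := ih (x := N.map.act w x) (y := N.map.act w y) (by omega)
          (hA.mono (Finset.sdiff_subset_sdiff hss.subset subset_rfl)) hU
        refine ⟨w ++ w', by rw [BooleanNetwork.act_append, BooleanNetwork.act_append, hw'], ?_⟩
        rw [List.length_append]
        omega
      by_cases hd' : (diff x y).card ≤ d
      · obtain ⟨w, hw, hlen⟩ := ih hd' hA hU
        exact ⟨w, hw, by omega⟩
      obtain ⟨U', hU', hcard⟩ := hR.exists_entrySet hni (U₀ := diff x y ∩ U)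
        Finset.inter_subset_left (by rwa [Finset.sdiff_inter_self_left])
      have hcard' := hcard.trans (Finset.card_le_card Finset.inter_subset_right)
      by_cases hUm : U'.card ≤ m
      · obtain ⟨w, hw, hlen⟩ := ihm (d + 1) hd hU'.acyc hUm
        exact ⟨w, hw, hlen.trans (mergeCost_succ_left s n m (d + 1))⟩
      have hne : (diff x y).Nonempty := Finset.card_pos.1 (by omega)
      obtain ⟨w₁, hw₁, hlen₁, hprimed⟩ := hU'.exists_primed hc hR
      have hdiff := hR.diff_act hw₁
      have hs' := hs _ hU'.acyc
      have hsd := Finset.card_sdiff_add_card_eq_card hU'.subset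
      have hk : (Finset.univ \ (diff (N.map.act w₁ x) (N.map.act w₁ y) ∪ ∅)).card = n - (d + 1) := by
        rw [hdiff, Finset.union_empty, ← Finset.compl_eq_univ_sdiff, Finset.card_compl]
        omega
      have hspread : N.Spread (diff x y) ∅ (N.map.act w₁ x) (N.map.act w₁ y) := by
        have hiff : ∀ {b}, N.map.act w₁ x b ≠ N.map.act w₁ y b ↔ b ∈ diff x y := by
          intro b
          rw [← hdiff, mem_diff]
        exact ⟨fun b hb => hiff.2 hb, by simp, fun b hb hb' => absurd (hiff.1 hb) hb',
          fun b hb hb' => absurd (hiff.1 hb) hb', by simp⟩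
      have hphase : phaseCost (n - (d + 1)) ≤ phaseCost (n - (m + 1)) :=
        phaseCost_mono (by omega)
      have hlevel : w₁.length + phaseCost (n - (d + 1)) ≤ levelCost s n (m + 1) := by
        unfold levelCost
        omega
      rcases hspread.breached_or_invaded hin hv hc hR hne hU' _ hk hprimed (fun _ _ => rfl)
        (fun i hi => by rwa [← notMem_diff, hdiff]) with hb | hi
      · obtain ⟨w₂, hlen₂, hss⟩ := hb.exists_ssubset hR
        have hlt := Finset.card_lt_card hss
        obtain ⟨w₃, hw₃, hlen₃⟩ := ih (x := N.map.act w₂ (N.map.act w₁ x))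
          (y := N.map.act w₂ (N.map.act w₁ y)) (by omega)
          (hU'.acyc.mono (Finset.sdiff_subset_sdiff hss.subset subset_rfl)) (by omega)
        refine ⟨w₁ ++ w₂ ++ w₃, by simp only [BooleanNetwork.act_append, hw₃], ?_⟩
        simp only [List.length_append]
        -- The set D \ U' is acyclic, so d - m ≤ s. At a given level a rigid difference thus has one
        -- of only s + 1 sizes, which bounds the number of infection phases.
        have e1 : min (d + 1 - m) (s + 1) = min (d - m) (s + 1) + 1 := by omega
        simp only [mergeCost] at hlen₃ ⊢
        rw [e1, Nat.add_mul d, Nat.add_mul (min (d - m) (s + 1))]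
        omega
      · obtain ⟨w₂, c, hlen₂, hc₂, v, hvU, hA₂⟩ := hi.exists_cut hc hs hU'
        obtain ⟨w₃, hw₃, hlen₃⟩ := ihm _ le_rfl hA₂ (by
          rw [Finset.card_erase_of_mem hvU]
          omega)
        refine ⟨w₁ ++ w₂ ++ w₃, by simp only [BooleanNetwork.act_append, hw₃], ?_⟩
        simp only [List.length_append]
        have e1 := mergeCost_le s n m
          (diff (N.map.act w₂ (N.map.act w₁ x)) (N.map.act w₂ (N.map.act w₁ y))).card
        set d₂ := (diff (N.map.act w₂ (N.map.act w₁ x)) (N.map.act w₂ (N.map.act w₁ y))).card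
        have e2 : 1 ≤ min (d + 1 - m) (s + 1) := by omega
        have e3 := Nat.mul_le_mul_right (levelCost s n (m + 1)) e2
        -- After the cut c + d₂ ≤ n - 1, while d + 1 ≥ m + 1, so the difference can have grown by at
        -- most n - 1 - (m + 1); the c alignment updates fit in the same allowance.
        have e4 : (c + d₂) * (s + 2) ≤ (d + 1 + (n - 1 - (m + 1))) * (s + 2) :=
          Nat.mul_le_mul_right _ (by omega)
        have e5 : c ≤ c * (s + 2) := Nat.le_mul_of_pos_right _ (by omega)
        rw [Nat.add_mul, Nat.add_mul] at e4
        rw [mergeCost, cutCost]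
        omega

end CanalizingNet

/-! ### Cost estimates and the synchronizing word. -/

namespace CanalizingNet

open Nat (fib)

theorem phaseCost_cast (k : ℕ) : (phaseCost k : ℤ) = 2 * fib (k + 3) - 3 - k := by
  have := phaseCost_add k
  omega

/-- Writing n = m + q + 1 with q arbitrary avoids truncated subtraction and lets the induction on m
shift q; the factor 2 clears the halves of the triangular sums. -/
theorem two_mul_sum_levelCost (s m : ℕ) : ∀ q : ℕ,
    2 * ∑ k ∈ Finset.range m, (((s + 1) * levelCost s (m + q + 1) (k + 1) +
      cutCost s (m + q + 1) (k + 1) : ℕ) : ℤ) =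
    (s + 1) * (4 * s * m - 2 * m - 2 * m * q + 4 * (fib (m + q + 5) - fib (q + 5))) +
      (s + 2) * (m ^ 2 + 2 * m * q - m) := by
  induction m with
  | zero => simp
  | succ m ih =>
    intro q
    have h := ih (q + 1)
    rw [Finset.sum_range_succ, mul_add, show m + 1 + q + 1 = m + (q + 1) + 1 by ring, h]
    have e1 : m + (q + 1) + 1 - (m + 1) = q + 1 := by omega
    have e2 : m + (q + 1) + 1 - 1 - (m + 1) = q := by omega
    have e3 : (fib (q + 1 + 5) : ℤ) = fib (q + 4) + fib (q + 5) := by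
      rw [show q + 1 + 5 = q + 4 + 2 by ring, Nat.fib_add_two]; push_cast; ring
    have e4 : m + 1 + q + 5 = m + (q + 1) + 5 := by ring
    simp only [levelCost, cutCost, e1, e2, e4]
    push_cast
    rw [phaseCost_cast, e3, show q + 1 + 3 = q + 4 by ring]
    push_cast
    ring

theorem two_mul_mergeCost (s n : ℕ) :
    2 * (mergeCost s (n + 1) (n + 1) (n + 1) : ℤ) =
      (s + 1) * (4 * s * n - 20 - 2 * n + 4 * fib (n + 5)) + (s + 2) * (n ^ 2 + n + 2) +
        (8 * s + 2 * n + 8) := by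
  have h := two_mul_sum_levelCost s n 0
  have h5 : fib (0 + 5) = 5 := rfl
  have h3 : phaseCost 0 = 1 := rfl
  have e : min (n + 1 - n) (s + 1) = 1 := by omega
  simp only [mergeCost, e]
  rw [h5] at h
  simp only [add_zero] at h
  push_cast at h ⊢
  rw [mul_add, h, levelCost, cutCost, show n + 1 - (n + 1) = 0 by omega,
    show n + 1 - 1 - (n + 1) = 0 by omega, h3]
  push_cast
  ring

theorem two_mul_mul_succ_le (s : ℕ) : 2 * s * (s + 1) ≤ 3 * 2 ^ s := by
  rcases Nat.lt_or_ge s 3 with hs | hs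
  · interval_cases s <;> norm_num
  · induction s, hs using Nat.le_induction with
    | base => norm_num
    | succ k hk ih =>
      rw [pow_succ]
      nlinarith

/-- All dependence on s is absorbed into 2^s, which will cancel against the 2^(n - s) merges. -/
theorem mergeCost_le_two_pow (s n : ℕ) :
    mergeCost s (n + 1) (n + 1) (n + 1) + 4 * 2 ^ s ≤ 2 ^ s * (n ^ 2 + 4 * n + 2 * fib (n + 5)) := by
  have h := two_mul_mergeCost s n
  have h1 : s + 1 ≤ 2 ^ s := Nat.lt_two_pow_self
  have h2 := two_mul_mul_succ_le s
  have h3 : n + 10 ≤ 2 * fib (n + 5) := add_two_mul_fib_le (f := n) (h := 3) (k := n + 3) le_rfl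
  generalize 2 ^ s = T at *
  generalize fib (n + 5) = F at *
  zify at h1 h2 h3 ⊢
  have e1 : (n : ℤ) * (2 * s * (s + 1)) ≤ n * (3 * T) := mul_le_mul_of_nonneg_left h2 (by positivity)
  have e2 : ((s : ℤ) + 1) * (4 * F - 20 - 2 * n) ≤ T * (4 * F - 20 - 2 * n) :=
    mul_le_mul_of_nonneg_right h1 (by linarith)
  have e3 : ((s : ℤ) + 2) * (n ^ 2 + n + 2) ≤ 2 * T * (n ^ 2 + n + 2) :=
    mul_le_mul_of_nonneg_right (by linarith) (by positivity)
  have e4 : (n : ℤ) * 1 ≤ n * T := mul_le_mul_of_nonneg_left (by linarith) (by positivity)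
  nlinarith

/-- The Fibonacci and golden ratio terms obey the same recursion. The polynomial part n² + 4n grows
more slowly than that recursion from n = 5 on, with room for the constant 4; smaller cases are
numerical. -/
theorem add_fib_le_goldenRatio_pow (n : ℕ) :
    ((n ^ 2 + 4 * n + 2 * fib (n + 5) : ℕ) : ℝ) ≤ 10 * Real.goldenRatio ^ (n + 1) + 4 := by
  have hφ : (1.618 : ℝ) ≤ Real.goldenRatio := by
    have : (2.236 : ℝ) ≤ √5 := Real.le_sqrt_of_sq_le (by norm_num)
    unfold Real.goldenRatio
    linarith
  have hsq := Real.goldenRatio_sq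
  set φ := Real.goldenRatio
  have e3 : φ ^ 3 = 2 * φ + 1 := by linear_combination (φ + 1) * hsq
  have e4 : φ ^ 4 = 3 * φ + 2 := by linear_combination (φ ^ 2 + φ + 2) * hsq
  have e5 : φ ^ 5 = 5 * φ + 3 := by linear_combination (φ ^ 3 + φ ^ 2 + 2 * φ + 3) * hsq
  induction n using Nat.strong_induction_on with
  | _ n ih =>
  rcases Nat.lt_or_ge n 5 with hn | hn
  · interval_cases n
    · norm_num [Nat.fib_add_two]; linarith
    · norm_num [Nat.fib_add_two]; linarith
    · norm_num [Nat.fib_add_two]; linarith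
    · norm_num [Nat.fib_add_two]; linarith
    · norm_num [Nat.fib_add_two]; linarith
  · obtain ⟨k, rfl⟩ : ∃ k, n = k + 2 := ⟨n - 2, by omega⟩
    have h1 := ih k (by omega)
    have h2 := ih (k + 1) (by omega)
    have h3 : fib (k + 2 + 5) = fib (k + 5) + fib (k + 1 + 5) := Nat.fib_add_two
    have h4 : φ ^ (k + 2 + 1) = φ ^ (k + 1 + 1) + φ ^ (k + 1) := by
      linear_combination φ ^ (k + 1) * hsq
    have h5 : (3 : ℝ) ≤ k := by exact_mod_cast (show 3 ≤ k by omega)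
    rw [h3, h4]
    push_cast at h1 h2 ⊢
    nlinarith

section

variable {V : Type*} [Fintype V] [DecidableEq V] {N : CanalizingNet V}

/-- Once S is stable, a configuration is determined by its values outside S. -/
theorem card_image_act_le {S : Finset V} (hA : N.Acyc S) {l : List V}
    (hst : ∀ x, ∀ b ∈ S, N.map (N.map.act l x) b = N.map.act l x b) :
    (Finset.univ.image (N.map.act l)).card ≤ 2 ^ (Fintype.card V - S.card) := by
  have hinj : Set.InjOn (fun (x : V → Bool) (i : {i // i ∈ Sᶜ}) => x i)
      (Finset.univ.image (N.map.act l)) := by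
    intro p hp q hq hpq
    simp only [Finset.coe_image, Finset.coe_univ, Set.image_univ, Set.mem_range] at hp hq
    obtain ⟨x, rfl⟩ := hp
    obtain ⟨y, rfl⟩ := hq
    exact hA.eq_of_stable (hst x) (hst y) fun b hb =>
      congrFun hpq ⟨b, Finset.mem_compl.2 hb⟩
  have := Finset.card_le_card_of_injOn _ (fun _ _ => Finset.mem_coe.2 (Finset.mem_univ _)) hinj
  simpa [Finset.card_univ, Finset.card_compl] using this

/-- Merging two points of the image removes at least one point from it. -/
theorem exists_synchronizing_append {P : ℕ}
    (hP : ∀ x y, ∃ w : List V, N.map.act w x = N.map.act w y ∧ w.length ≤ P) :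
    ∀ (k : ℕ) (w : List V), (Finset.univ.image (N.map.act w)).card ≤ k + 1 →
      ∃ w' : List V, N.map.IsSynchronizingWord (w ++ w') ∧ w'.length ≤ k * P := by
  intro k
  induction k with
  | zero =>
    intro w hw
    obtain ⟨z, hz⟩ := Finset.card_le_one_iff_subset_singleton.1 hw
    exact ⟨[], ⟨z, fun x => by simpa using hz (Finset.mem_image_of_mem _ (Finset.mem_univ x))⟩,
      by simp⟩
  | succ k ih =>
    intro w hw
    by_cases hall : ∀ x y, N.map.act w x = N.map.act w y
    · exact ⟨[], ⟨N.map.act w fun _ => true, fun x => by rw [List.append_nil]; exact hall _ _⟩,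
        by simp⟩
    push Not at hall
    obtain ⟨x, y, hxy⟩ := hall
    obtain ⟨w₁, hw₁, hlen₁⟩ := hP (N.map.act w x) (N.map.act w y)
    have himage : Finset.univ.image (N.map.act (w ++ w₁)) =
        (Finset.univ.image (N.map.act w)).image (N.map.act w₁) := by
      rw [Finset.image_image]
      congr 1
      funext z
      exact BooleanNetwork.act_append _ _ _ _
    have hlt : (Finset.univ.image (N.map.act (w ++ w₁))).card <
        (Finset.univ.image (N.map.act w)).card := by
      rw [himage]
      refine lt_of_le_of_ne Finset.card_image_le fun he => hxy ?_
      exact Finset.card_image_iff.1 he (by simp) (by simp) hw₁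
    obtain ⟨w', hw', hlen'⟩ := ih (w ++ w₁) (by omega)
    refine ⟨w₁ ++ w', by rwa [← List.append_assoc], ?_⟩
    rw [List.length_append, Nat.add_mul, Nat.one_mul]
    omega

theorem exists_synchronizing (hin : ∀ i, (N.inputs i).Nonempty) (hv : N.VirtuallyAccessible)
    (hc : N.NoConsistentCycle) (hni : N.NoInitialCycle) :
    ∃ w : List V, N.map.IsSynchronizingWord w ∧
      (w.length : ℝ) ≤ 10 * (√5 + 1) ^ Fintype.card V := by
  classical
  obtain ⟨S, hS, hmax⟩ := Finset.exists_max_image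
    (Finset.univ.filter fun S : Finset V => N.Acyc S) Finset.card
    ⟨∅, Finset.mem_filter.2 ⟨Finset.mem_univ _, fun W hW hne => by simp_all⟩⟩
  have hA := (Finset.mem_filter.1 hS).2
  have hs : ∀ S', N.Acyc S' → S'.card ≤ S.card := fun S' hS' =>
    hmax S' (Finset.mem_filter.2 ⟨Finset.mem_univ _, hS'⟩)
  set n := Fintype.card V with hn
  have hmerge : ∀ x y, ∃ w : List V, N.map.act w x = N.map.act w y ∧
      w.length ≤ mergeCost S.card n n n := fun x y =>
    exists_merge hin hv hc hni hs n n (U := diff x y) (Finset.card_le_univ _)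
      (by simp only [sdiff_self]; intro W hW hne; simp_all) (Finset.card_le_univ _)
  obtain ⟨l, -, hlen, hst⟩ := hA.exists_stabilizing _ rfl
  have himage := card_image_act_le hA hst
  rw [← hn] at himage
  have hpow : 0 < 2 ^ (n - S.card) := by positivity
  obtain ⟨w, hw, hwlen⟩ := exists_synchronizing_append hmerge (2 ^ (n - S.card) - 1) l (by omega)
  refine ⟨l ++ w, hw, ?_⟩
  have hSn : S.card ≤ n := Finset.card_le_univ S
  have hle : (l ++ w).length ≤ 2 ^ (n - S.card) * mergeCost S.card n n n := by
    rw [List.length_append, hlen]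
    -- The stabilizing word is no longer than one merge, so it takes the place of the merge saved in
    -- 2^(n - s) - 1.
    have h1 : S.card ≤ mergeCost S.card n n n := by
      cases hn' : n with
      | zero => omega
      | succ n =>
        rw [mergeCost, Nat.add_mul]
        omega
    obtain ⟨q, hq⟩ : ∃ q, 2 ^ (n - S.card) = q + 1 := ⟨_, (Nat.succ_pred_eq_of_pos hpow).symm⟩
    rw [hq] at hwlen ⊢
    rw [Nat.add_mul, Nat.one_mul]
    simp only [Nat.add_sub_cancel] at hwlen
    omega
  cases hn' : n with
  | zero =>
    rw [hn'] at hle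
    have : (l ++ w).length = 0 := by simpa [mergeCost] using hle
    rw [this]
    norm_num
  | succ m =>
    rw [hn'] at hle hSn
    have h1 := mergeCost_le_two_pow S.card m
    have h2 := add_fib_le_goldenRatio_pow m
    have h3 : 2 ^ (m + 1 - S.card) * 2 ^ S.card = 2 ^ (m + 1) := by
      rw [← pow_add, Nat.sub_add_cancel hSn]
    have h4 : (l ++ w).length + 4 * 2 ^ (m + 1) ≤
        2 ^ (m + 1) * (m ^ 2 + 4 * m + 2 * fib (m + 5)) := by
      calc (l ++ w).length + 4 * 2 ^ (m + 1)
          ≤ 2 ^ (m + 1 - S.card) * mergeCost S.card (m + 1) (m + 1) (m + 1) + 4 * 2 ^ (m + 1) := by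
            omega
        _ = 2 ^ (m + 1 - S.card) *
            (mergeCost S.card (m + 1) (m + 1) (m + 1) + 4 * 2 ^ S.card) := by
            rw [← h3]; ring
        _ ≤ 2 ^ (m + 1 - S.card) * (2 ^ S.card * (m ^ 2 + 4 * m + 2 * fib (m + 5))) :=
            Nat.mul_le_mul_left _ h1
        _ = _ := by rw [← mul_assoc, h3]
    have h5 : ((l ++ w).length : ℝ) + 4 * 2 ^ (m + 1) ≤
        2 ^ (m + 1) * ((m ^ 2 + 4 * m + 2 * fib (m + 5) : ℕ) : ℝ) := by exact_mod_cast h4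
    have h6 : (√5 + 1) ^ (m + 1) = 2 ^ (m + 1) * Real.goldenRatio ^ (m + 1) := by
      rw [← mul_pow, Real.goldenRatio]
      ring
    have h7 := mul_le_mul_of_nonneg_left h2 (show (0 : ℝ) ≤ 2 ^ (m + 1) by positivity)
    rw [h6]
    linarith

end

end CanalizingNet

/-! ### Consistent paths, and initial cycles from predecessor maps. -/

namespace SignedDigraph

variable {V : Type*} {G : SignedDigraph V}

theorem isWalk_append {j i : V} {p q : List (ℤˣ × V)} :
    G.IsWalk j (p ++ q) i ↔ ∃ k, G.IsWalk j p k ∧ G.IsWalk k q i := by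
  induction p generalizing j with
  | nil => simp [IsWalk]
  | cons a p ih =>
    obtain ⟨s, k⟩ := a
    simp only [List.cons_append, IsWalk, ih]
    constructor
    · rintro ⟨h, l, h1, h2⟩
      exact ⟨l, ⟨h, h1⟩, h2⟩
    · rintro ⟨l, ⟨h, h1⟩, h2⟩
      exact ⟨h, l, h1, h2⟩

theorem IsWalk.mem {j i : V} {p : List (ℤˣ × V)} (h : G.IsWalk j p i) :
    i ∈ j :: p.map Prod.snd := by
  induction p generalizing j with
  | nil => simp only [IsWalk] at h; simp [h]
  | cons a p ih =>
    obtain ⟨s, k⟩ := a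
    simpa using Or.inr (ih h.2)

theorem IsWalk.mono {G' : SignedDigraph V} (hG : ∀ j i s, G.Arc j i s → G'.Arc j i s) {j i : V}
    {p : List (ℤˣ × V)} (h : G.IsWalk j p i) : G'.IsWalk j p i := by
  induction p generalizing j with
  | nil => exact h
  | cons a p ih => exact ⟨hG _ _ _ h.1, ih h.2⟩

theorem IsPath.exists_of_mem {j i v : V} {p : List (ℤˣ × V)} (h : G.IsPath j p i)
    (hv : v ∈ j :: p.map Prod.snd) : ∃ q, G.IsPath v q i := by
  induction p generalizing j with
  | nil =>
    rw [List.map_nil, List.mem_singleton] at hv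
    exact ⟨[], hv ▸ h⟩
  | cons a p ih =>
    obtain ⟨s, k⟩ := a
    rcases List.mem_cons.1 hv with rfl | hv
    · exact ⟨_, h⟩
    · exact ih ⟨h.1.2, (List.nodup_cons.1 h.2).2⟩ hv

theorem Reach.exists_isPath {j i : V} (h : G.Reach j i) : ∃ p, G.IsPath j p i := by
  induction h using Relation.ReflTransGen.head_induction_on with
  | refl => exact ⟨[], rfl, by simp⟩
  | @head j k hjk _ ih =>
    obtain ⟨s, hs⟩ := hjk
    obtain ⟨p, hp⟩ := ih
    by_cases hj : j ∈ k :: p.map Prod.snd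
    · exact hp.exists_of_mem hj
    · exact ⟨(s, k) :: p, ⟨hs, hp.1⟩, List.nodup_cons.2 ⟨hj, hp.2⟩⟩

theorem exists_isCycle {v : V} (h : Relation.TransGen G.Adj v v) : ∃ p, G.IsCycle v p := by
  obtain ⟨u, ⟨s, hs⟩, hu⟩ := Relation.TransGen.head'_iff.1 h
  obtain ⟨p, hp⟩ := Reach.exists_isPath hu
  exact ⟨(s, u) :: p, by simp, ⟨hs, hp.1⟩, hp.2⟩

/-- The sign of the consistent arcs between vertices with values `a` and `b`. -/
def valueSign (a b : Bool) : ℤˣ := if a = b then 1 else -1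

/-- The arcs of `G` inside `S` that are consistent in `x`. -/
def consistent (G : SignedDigraph V) (x : V → Bool) (S : Set V) : SignedDigraph V where
  Arc j i s := G.Arc j i s ∧ s = valueSign (x j) (x i) ∧ j ∈ S ∧ i ∈ S

theorem IsWalk.of_consistent {x : V → Bool} {S : Set V} {j i : V} {p : List (ℤˣ × V)}
    (h : (G.consistent x S).IsWalk j p i) : G.IsWalk j p i :=
  h.mono fun _ _ _ h' => And.left h'

/-- The product of the signs telescopes; for a closed walk it is 1. -/
theorem sign_consistent {x : V → Bool} {S : Set V} {j i : V} {p : List (ℤˣ × V)}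
    (h : (G.consistent x S).IsWalk j p i) : sign p = valueSign (x j) (x i) := by
  induction p generalizing j with
  | nil =>
    simp only [IsWalk] at h
    simp [sign, valueSign, h]
  | cons a p ih =>
    obtain ⟨s, k⟩ := a
    have h1 := ih h.2
    have h2 : s = valueSign (x j) (x k) := h.1.2.1
    have : sign ((s, k) :: p) = s * sign p := by simp [sign]
    rw [this, h1, h2]
    generalize x j = a, x k = b, x i = c
    revert a b c
    decide

/-- A nonempty finite set on which there is no positive cycle has a vertex without consistent input in
that set. -/
theorem NoPositiveCycle.exists_forall_not_adj [Finite V] (hG : G.NoPositiveCycle) (x : V → Bool)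
    {S : Set V} (hS : S.Nonempty) : ∃ b ∈ S, ∀ j, ¬ (G.consistent x S).Adj j b := by
  have hirr : ∀ v, ¬ Relation.TransGen (G.consistent x S).Adj v v := fun v hv => by
    obtain ⟨p, hp⟩ := exists_isCycle hv
    refine hG v p ⟨hp.1, hp.2.1.of_consistent, hp.2.2⟩ ?_
    rw [sign_consistent hp.2.1]
    simp [valueSign]
  have : Std.Irrefl (Relation.TransGen (G.consistent x S).Adj) := ⟨hirr⟩
  have hwf : WellFounded (Relation.TransGen (G.consistent x S).Adj) :=
    Finite.wellFounded_of_trans_of_irrefl _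
  obtain ⟨b, hb, hmin⟩ := hwf.has_min S hS
  refine ⟨b, hb, fun j hj => hmin j ?_ (Relation.TransGen.single hj)⟩
  obtain ⟨s, hs⟩ := hj
  exact hs.2.2.1

theorem Reach.mem_of_closed {S : Set V} (hS : ∀ i ∈ S, ∀ j, G.Adj j i → j ∈ S) {j i : V}
    (h : G.Reach j i) (hi : i ∈ S) : j ∈ S := by
  induction h using Relation.ReflTransGen.head_induction_on with
  | refl => exact hi
  | head hjk _ ih => exact hS _ ih _ hjk

/-- If each vertex of a nonempty finite set has a unique in-neighbour, which belongs to that set, then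
there is an initial cycle. -/
theorem exists_isInitialCycle {C : Finset V} (hC : C.Nonempty) {π : V → V}
    (hπ : ∀ b ∈ C, π b ∈ C) (hadj : ∀ b ∈ C, ∀ j, G.Adj j b ↔ j = π b) :
    ∃ I, G.IsInitialCycle I := by
  obtain ⟨c, hc⟩ := hC
  have hit : ∀ m, π^[m] c ∈ C := fun m => by
    induction m with
    | zero => exact hc
    | succ m ih => rw [Function.iterate_succ_apply']; exact hπ _ ih
  obtain ⟨m, n, hmn, heq⟩ : ∃ m n, m < n ∧ π^[m] c = π^[n] c := by
    obtain ⟨m, n, hne, h⟩ := Finite.exists_ne_map_eq_of_infinite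
      (fun m : ℕ => (⟨π^[m] c, hit m⟩ : C))
    have h' : π^[m] c = π^[n] c := congrArg Subtype.val h
    rcases lt_or_gt_of_ne hne with h1 | h1
    exacts [⟨m, n, h1, h'⟩, ⟨n, m, h1, h'.symm⟩]
  set v := π^[m] c with hv
  have hper : Function.IsPeriodicPt π (n - m) v := by
    change π^[n - m] v = v
    rw [hv, ← Function.iterate_add_apply, Nat.sub_add_cancel hmn.le, ← heq]
  have hvC : ∀ l, π^[l] v ∈ C := fun l => by
    rw [hv, ← Function.iterate_add_apply]
    exact hit _
  set k := Function.minimalPeriod π v with hk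
  have hkpos : 0 < k := hper.minimalPeriod_pos (by omega)
  have : NeZero k := ⟨hkpos.ne'⟩
  set I : Set V := Set.range fun l => π^[l] v with hI
  have hclosed : ∀ i ∈ I, ∀ j, G.Adj j i → j ∈ I := by
    rintro _ ⟨l, rfl⟩ j hj
    rw [(hadj _ (hvC l) j).1 hj]
    exact ⟨l + 1, Function.iterate_succ_apply' _ _ _⟩
  have hreach : ∀ l, G.Reach (π^[l] v) v := fun l => by
    induction l with
    | zero => exact Relation.ReflTransGen.refl
    | succ l ih =>
      refine Relation.ReflTransGen.head ?_ ih
      rw [Function.iterate_succ_apply']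
      exact (hadj _ (hvC l) _).2 rfl
  have hreach' : ∀ l, ∀ u, (∃ a, u = π^[a] v) → G.Reach (π^[l] u) u := fun l u hu => by
    obtain ⟨a, rfl⟩ := hu
    induction l with
    | zero => exact Relation.ReflTransGen.refl
    | succ l ih =>
      refine Relation.ReflTransGen.head ?_ ih
      rw [Function.iterate_succ_apply', ← Function.iterate_add_apply]
      exact (hadj _ (hvC _) _).2 rfl
  refine ⟨I, ⟨v, ?_⟩, fun j i hj hi hji => hj (hclosed i hi j hji), k, hkpos, ?_⟩
  · ext j
    constructor
    · rintro ⟨l, rfl⟩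
      refine ⟨hreach l, ?_⟩
      have h1 : π^[k * l - l] (π^[l] v) = v := by
        have : l ≤ k * l := Nat.le_mul_of_pos_left _ hkpos
        rw [← Function.iterate_add_apply, Nat.sub_add_cancel this]
        exact (Function.isPeriodicPt_minimalPeriod π v).mul_const l
      have h2 := hreach' (k * l - l) (π^[l] v) ⟨l, rfl⟩
      rwa [h1] at h2
    · rintro ⟨h, -⟩
      exact h.mem_of_closed hclosed ⟨0, rfl⟩
  · have hmod : ∀ a : ℕ, π^[(a : ZMod k).val] v = π^[a] v := fun a => by
      rw [ZMod.val_natCast, hk, Function.iterate_mod_minimalPeriod_eq]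
    -- The map π goes against the arcs, so indices are negated to make them increase along arcs.
    let e : ZMod k → I := fun u => ⟨π^[(-u).val] v, ⟨_, rfl⟩⟩
    have hbij : Function.Bijective e := by
      constructor
      · intro a b hab
        have h1 : π^[(-a).val] v = π^[(-b).val] v := congrArg Subtype.val hab
        have h2 := Function.iterate_injOn_Iio_minimalPeriod (ZMod.val_lt (-a))
          (ZMod.val_lt (-b)) h1
        exact neg_injective (ZMod.val_injective k h2)
      · rintro ⟨_, l, rfl⟩
        refine ⟨-(l : ZMod k), Subtype.ext ?_⟩
        change π^[(- -(l : ZMod k)).val] v = π^[l] v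
        rw [neg_neg, hmod]
    refine ⟨Equiv.ofBijective e hbij, fun a b => ?_⟩
    have hpred : π (e b) = e (b - 1) := by
      change π (π^[(-b).val] v) = π^[(-(b - 1)).val] v
      have h1 : (((-b).val + 1 : ℕ) : ZMod k) = -(b - 1) := by
        push_cast
        rw [ZMod.natCast_zmod_val]
        ring
      rw [show π (π^[(-b).val] v) = π^[(-b).val + 1] v from
        (Function.iterate_succ_apply' _ _ _).symm, ← hmod, h1]
    rw [Equiv.ofBijective_apply, Equiv.ofBijective_apply, hadj _ (hvC _), hpred,
      Subtype.coe_inj, hbij.injective.eq_iff, eq_sub_iff_add_eq, eq_comm]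

end SignedDigraph

/-! ### And-or-nets as canalizing nets, and homogeneity. -/

namespace BooleanNetwork

variable {V : Type*} {f : BooleanNetwork V} {G : SignedDigraph V}

section

variable [DecidableEq V]

/-- Opposite literals of j would make the component i constant, and then no arc would enter i. -/
theorem IsAndOrNetOn.arc_unique (hf : f.IsAndOrNetOn G) {j i : V} (h₁ : G.Arc j i 1)
    (h₂ : G.Arc j i (-1)) : False := by
  have hconst : ∃ a, ∀ x, f x i = a := by
    rcases hf.2 i with h | h
    · refine ⟨false, fun x => ?_⟩
      rw [← Bool.not_eq_true, h x]
      rintro ⟨h3, h4⟩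
      simpa [h3 j h₁] using h4 j h₂
    · refine ⟨true, fun x => ?_⟩
      rw [← Bool.not_eq_false, h x]
      rintro ⟨h3, h4⟩
      simpa [h3 j h₁] using h4 j h₂
  obtain ⟨a, ha⟩ := hconst
  have h₁' : f.interactionDigraph.Arc j i 1 := hf.1 ▸ h₁
  obtain ⟨x, -, ⟨-, h3, h4⟩ | ⟨-, h3, h4⟩⟩ := h₁'
  · rw [ha] at h3 h4
    simp [h3] at h4
  · rw [ha] at h3 h4
    simp [h3] at h4

end

variable [Fintype V]

open Classical in
/-- An and-or-net on `G` as a net of conjunctions and disjunctions of literals. -/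
noncomputable def toCanalizingNet (f : BooleanNetwork V) (G : SignedDigraph V) :
    CanalizingNet V where
  inputs i := Finset.univ.filter fun j => G.Adj j i
  top i := decide (f.IsConjunctionAt G i)
  lit j i := if G.Arc j i 1 then decide (f.IsConjunctionAt G i)
    else !decide (f.IsConjunctionAt G i)

theorem mem_inputs {j i : V} : j ∈ (f.toCanalizingNet G).inputs i ↔ G.Adj j i := by
  simp [toCanalizingNet]

theorem noInitialCycle (hinit : ¬ ∃ I : Set V, G.IsInitialCycle I) :
    (f.toCanalizingNet G).NoInitialCycle := by
  intro C hC h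
  choose! π hπ using h
  refine hinit (SignedDigraph.exists_isInitialCycle hC (fun b hb => (hπ b hb).1) fun b hb j => ?_)
  rw [← mem_inputs (f := f), (hπ b hb).2, Finset.mem_singleton]

variable [DecidableEq V]

theorem IsAndOrNetOn.lit_of_arc (hf : f.IsAndOrNetOn G) {j i : V} {s : ℤˣ} (h : G.Arc j i s) :
    (f.toCanalizingNet G).lit j i =
      if s = 1 then (f.toCanalizingNet G).top i else !(f.toCanalizingNet G).top i := by
  rcases Int.units_eq_one_or s with rfl | rfl
  · simp [toCanalizingNet, h]
  · have : ¬ G.Arc j i 1 := fun h' => hf.arc_unique h' h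
    simp [toCanalizingNet, this]

theorem IsAndOrNetOn.cons_iff (hf : f.IsAndOrNetOn G) {x : V → Bool} {j i : V} {s : ℤˣ}
    (h : G.Arc j i s) :
    (f.toCanalizingNet G).Cons x j i ↔ s = SignedDigraph.valueSign (x j) (x i) := by
  unfold CanalizingNet.Cons
  rw [hf.lit_of_arc h]
  generalize x j = a, x i = b, (f.toCanalizingNet G).top i = c
  revert s a b c
  intro s _
  rcases Int.units_eq_one_or s with rfl | rfl <;> decide

theorem IsAndOrNetOn.forall_lit_iff (hf : f.IsAndOrNetOn G) {x : V → Bool} {i : V} :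
    (∀ j ∈ (f.toCanalizingNet G).inputs i, x j = (f.toCanalizingNet G).lit j i) ↔
      (∀ j, G.Arc j i 1 → x j = (f.toCanalizingNet G).top i) ∧
        ∀ j, G.Arc j i (-1) → x j = !(f.toCanalizingNet G).top i := by
  constructor
  · refine fun h => ⟨fun j hj => ?_, fun j hj => ?_⟩
    · rw [h j (mem_inputs.2 ⟨_, hj⟩), hf.lit_of_arc hj]
      simp
    · rw [h j (mem_inputs.2 ⟨_, hj⟩), hf.lit_of_arc hj]
      simp
  · rintro ⟨h1, h2⟩ j hj
    obtain ⟨s, hs⟩ := mem_inputs.1 hj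
    rw [hf.lit_of_arc hs]
    rcases Int.units_eq_one_or s with rfl | rfl
    · simpa using h1 j hs
    · simpa using h2 j hs

theorem IsAndOrNetOn.map_eq (hf : f.IsAndOrNetOn G) : (f.toCanalizingNet G).map = f := by
  funext x i
  by_cases hc : f.IsConjunctionAt G i
  · have htop : (f.toCanalizingNet G).top i = true := by simp [toCanalizingNet, hc]
    have h := hf.forall_lit_iff (x := x) (i := i)
    rw [htop] at h
    unfold CanalizingNet.map
    rw [htop]
    have h' := hc x
    split_ifs with h1
    · exact (h'.2 (h.1 h1)).symm
    · exact (Bool.eq_false_iff.2 fun h2 => h1 (h.2 (h'.1 h2))).symm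
  · have hd := (hf.2 i).resolve_left hc
    have htop : (f.toCanalizingNet G).top i = false := by simp [toCanalizingNet, hc]
    have h := hf.forall_lit_iff (x := x) (i := i)
    rw [htop] at h
    unfold CanalizingNet.map
    rw [htop]
    have h' := hd x
    split_ifs with h1
    · exact (h'.2 (h.1 h1)).symm
    · exact ((Bool.dichotomy _).resolve_left fun h2 => h1 (h.2 (h'.1 h2))).symm

theorem IsAndOrNetOn.consistent_adj (hf : f.IsAndOrNetOn G) {x : V → Bool} {S : Set V} {j i : V} :
    (G.consistent x S).Adj j i ↔ j ∈ S ∧ i ∈ S ∧ j ∈ (f.toCanalizingNet G).inputs i ∧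
      (f.toCanalizingNet G).Cons x j i := by
  constructor
  · rintro ⟨s, h1, h2, h3, h4⟩
    exact ⟨h3, h4, mem_inputs.2 ⟨s, h1⟩, (hf.cons_iff h1).2 h2⟩
  · rintro ⟨h1, h2, h3, h4⟩
    obtain ⟨s, hs⟩ := mem_inputs.1 h3
    exact ⟨s, hs, (hf.cons_iff hs).1 h4, h1, h2⟩

theorem IsAndOrNetOn.noConsistentCycle (hf : f.IsAndOrNetOn G) (hpos : G.NoPositiveCycle) :
    (f.toCanalizingNet G).NoConsistentCycle := by
  intro x S hS
  obtain ⟨b, hb, h⟩ := hpos.exists_forall_not_adj x (S := (S : Set V)) hS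
  exact ⟨b, hb, fun j hj hjb hc => h j (hf.consistent_adj.2 ⟨hj, hb, hjb, hc⟩)⟩

/-- The virtual arcs from t go to the vertices of Q whose forward paths to t share one sign, and β
is chosen so that such an arc is never satisfied together with a consistent path back to t. Since Q
is input-closed and misses t, a path from Q to t inside Q ∪ {t} is forward. For accessibility, a
nonempty R with no arc from Q \ R contains whole strong components, and homogeneity gives each of
them a vertex of J. -/
theorem IsAndOrNetOn.virtuallyAccessible (hf : f.IsAndOrNetOn G) (hhom : G.Homogenous)
    (hpos : G.NoPositiveCycle) : (f.toCanalizingNet G).VirtuallyAccessible := by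
  classical
  intro t Q ht hQ a
  have hQadj : ∀ i ∈ Q, ∀ j, G.Adj j i → j ∈ Q := fun i hi j hj => hQ i hi (mem_inputs.2 hj)
  refine ⟨Q.filter fun e => ∀ p q, G.IsForwardPath e p t → G.IsForwardPath e q t →
      SignedDigraph.sign p = SignedDigraph.sign q,
    fun e => if ∃ p, G.IsForwardPath e p t ∧ SignedDigraph.sign p = 1 then !a else a, ?_, ?_⟩
  · intro y hy S hS hne
    by_contra! hcon
    by_cases htS : t ∈ S
    swap
    · obtain ⟨b, hb, hb'⟩ := hf.noConsistentCycle hpos y S hne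
      obtain ⟨j, hj, hjb⟩ := hcon b hb
      rcases hjb with h | ⟨⟨rfl, -⟩, -⟩
      exacts [hb' j hj h.1 h.2, htS hj]
    -- Among the vertices of S with a consistent path to t, one has no consistent input from this
    -- set. Whatever accounts for it must be a virtual arc, which would close a forbidden cycle
    -- through t.
    obtain ⟨b, hb, hb'⟩ := hpos.exists_forall_not_adj y
      (S := {v | v ∈ S ∧ (G.consistent y (S : Set V)).Reach v t})
      ⟨t, htS, Relation.ReflTransGen.refl⟩
    obtain ⟨j, hj, hjb⟩ := hcon b hb.1
    rcases hjb with ⟨h1, h2⟩ | ⟨⟨-, hbJ⟩, hbβ⟩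
    · have hadj := (hf.consistent_adj (S := (S : Set V))).2 ⟨hj, hb.1, h1, h2⟩
      refine hb' j (hf.consistent_adj.2 ⟨⟨hj, ?_⟩, hb, h1, h2⟩)
      exact Relation.ReflTransGen.head hadj hb.2
    · obtain ⟨hbQ, hbh⟩ := Finset.mem_filter.1 hbJ
      obtain ⟨p, hp⟩ := SignedDigraph.Reach.exists_isPath hb.2
      have hsign := SignedDigraph.sign_consistent hp.1
      have hpath : G.IsPath b p t := ⟨hp.1.of_consistent, hp.2⟩
      have hforward : G.IsForwardPath b p t := by
        refine ⟨hpath, ?_⟩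
        rcases List.eq_nil_or_concat' p with rfl | ⟨q, ⟨s, v⟩, rfl⟩
        · have hbt : b = t := hp.1
          exact absurd (hbt ▸ hbQ) ht
        obtain ⟨k, hk1, hk2⟩ := SignedDigraph.isWalk_append.1 hp.1
        obtain ⟨hk2, rfl⟩ : (G.consistent y (S : Set V)).Arc k v s ∧ v = t := hk2
        refine ⟨q, s, k, rfl, hk1.of_consistent, fun hsame => ht ?_⟩
        have hkv : k ≠ v := by
          rintro rfl
          have := hp.2
          rw [List.map_append, ← List.cons_append, List.nodup_append] at this
          exact this.2.2 k hk1.mem k (by simp) rfl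
        have hkS : k ∈ S := hk2.2.2.1
        exact SignedDigraph.Reach.mem_of_closed (S := (Q : Set V)) hQadj hsame.2
          ((hS k hkS).resolve_left hkv)
      rw [hbβ, hy] at hsign
      beta_reduce at hsign
      split_ifs at hsign with hex
      · obtain ⟨p', hp', hs'⟩ := hex
        rw [hbh p p' hforward hp', hs'] at hsign
        revert hsign
        cases a <;> decide
      · refine hex ⟨p, hforward, ?_⟩
        rw [hsign]
        simp [SignedDigraph.valueSign]
  · intro R hR hne
    by_contra! hcon
    obtain ⟨e, he⟩ := hne
    have hRadj : ∀ i ∈ (R : Set V), ∀ j, G.Adj j i → j ∈ (R : Set V) := fun i hi j hj => by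
      by_contra hjR
      exact (hcon i hi).1 j (hQadj i (hR hi) j hj) hjR (mem_inputs.2 hj)
    obtain ⟨j, hj, hjh⟩ := hhom t {j | G.SameComponent j e} ⟨e, rfl⟩
    have hjR : j ∈ R := SignedDigraph.Reach.mem_of_closed hRadj hj.1 he
    exact (hcon j hjR).2 (Finset.mem_filter.2 ⟨hR hjR, hjh⟩)

end BooleanNetwork

theorem theorem4 {V : Type*} [Fintype V] [DecidableEq V] (G : SignedDigraph V)
    (hhom : G.Homogenous) (hpos : G.NoPositiveCycle) (hsource : ∀ i, ¬ G.IsSource i)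
    (hinit : ¬ ∃ I : Set V, G.IsInitialCycle I)
    (f : BooleanNetwork V) (hf : f.IsAndOrNetOn G) :
    ∃ w : List V, f.IsSynchronizingWord w ∧
      (w.length : ℝ) ≤ 10 * (Real.sqrt 5 + 1) ^ Fintype.card V := by
  have hin : ∀ i, ((f.toCanalizingNet G).inputs i).Nonempty := fun i => by
    have := hsource i
    unfold SignedDigraph.IsSource at this
    push Not at this
    exact this.imp fun j hj => BooleanNetwork.mem_inputs.2 hj
  have h := CanalizingNet.exists_synchronizing hin (hf.virtuallyAccessible hhom hpos)
    (hf.noConsistentCycle hpos) (BooleanNetwork.noInitialCycle hinit)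
  rwa [hf.map_eq] at h
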